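/- Setting. Fix a time step and a finite set of sensors $i$. Given are real matrices $A,Q,P_{k-1}\in\mathbb{R}^{n\times n}$ with $Q\succeq 0$, $P_{k-1}\succeq 0$ and $AP_{k-1}A^T+Q$ invertible, observation matrices $C_i\in\mathbb{R}^{m_i\times n}$ with $C_i\neq 0$ (which holds if $n\ge 1$ and $(A,C_i)$ is observable), noise covariances $R_i\succ 0$, channel gains $h_i>0$, maximum powers $p^i_{\max}>0$, SINR requirements $\theta_i>0$ and channel noise $\sigma^2>0$. Put $M(\gamma)=(AP_{k-1}A^T+Q)^{-1}+\sum_i\gamma_iC_i^TR_i^{-1}C_i$ and $D_i(p)=\sum_{j\ne i}h_jp_j+\sigma^2$. The relaxed problem in $(\gamma,p,P)$ is to minimize $\mathrm{Tr}\,P$ subject to $$\begin{bmatrix}M(\gamma)&I\\ I&P\end{bmatrix}\succeq 0,\qquad \frac{h_ip_i}{D_i(p)}\ge\gamma_i\theta_i,\qquad 0\le p_i\le p^i_{\max},\qquad 0\le\gamma_i\le 1\quad\text{for all } i.$$ Its equivalent form with auxiliary variables $\eta_i$, in $(\gamma,\eta,p,P)$, replaces the SINR constraint by $D_i(p)\le\eta_i$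 and $\eta_i\gamma_i\theta_i\le h_ip_i$. The surrogate problem with parameter $b$ is obtained from this form by replacing $\eta_i\gamma_i$ by its quadratic upper bound, that is, $\eta_i\gamma_i\theta_i\le h_ip_i$ by $$(\eta_i+\gamma_i)^2-2b_i(\eta_i-\gamma_i)+b_i^2\le\frac{4}{\theta_i}h_ip_i .$$ The SCA algorithm starts at a point $x^{(0)}=(\gamma,\eta,p,P)^{(0)}$ that is feasible for the form with auxiliary variables; $x^{(t+1)}$ is any optimal solution of the surrogate problem with $b_i=\eta_i^{(t)}-\gamma_i^{(t)}$. A converged solution of a run is a cluster point of $(x^{(t)})$ (in particular its limit, if it converges), or an iterate with $x^{(t+1)}=x^{(t)}$. The KKT conditions (with a multiplier $\lambda_j\ge 0$ for each scalar constraint and a matrix multiplier $Z\succeq 0$ for the matrix inequality) are feasibility, complementary slackness and stationarity of the Lagrangian. Proposition. The surrogate problem built at any feasible point has an optimal solution, so the algorithm is well defined. For every run: 1. the objective values $\mathrm{Tr}\,P^{(t)}$ are nonincreasing and bounded below by $0$, hence they converge; 2. the sequence of iterates is bounded and has a cluster point, so converged solutions exist; 3. for every converged solution $(\gamma,\eta,p,P)$,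 the point $(\gamma,p,P)$ is feasible for the relaxed problem, and $(\gamma,\eta,p,P)$ satisfies the KKT conditions of the relaxed problem written with the auxiliary variables $\eta$. If moreover $\eta_i=D_i(p)$ for every $i$ with $p_i=0$, then $(\gamma,p,P)$ satisfies the KKT conditions of the relaxed problem in its original variables. -/

import Mathlib

open Filter Topology

-- The entrywise maximum norm on real matrices, needed to speak of derivatives with respect to a
-- matrix variable.  The space is finite dimensional, so the choice of the norm is irrelevant.
attribute [local instance] Matrix.normedAddCommGroup Matrix.normedSpace

/-- A program `minimize f x  subject to  g_j x ≤ 0 (j ∈ J),  G x ⪰ 0` with finitely many scalar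
constraints and one matrix inequality. -/
structure ConicProgram (E J d : Type*) where
  /-- the objective `f` -/
  objective : E → ℝ
  /-- the scalar constraint functions `g_j` -/
  scalar : J → E → ℝ
  /-- the matrix constraint function `G` -/
  lmi : E → Matrix d d ℝ

namespace ConicProgram

variable {E J d : Type*}

/-- `x` satisfies all constraints.  `PosSemidef` includes symmetry. -/
def Feasible (pr : ConicProgram E J d) (x : E) : Prop :=
  (∀ j, pr.scalar j x ≤ 0) ∧ (pr.lmi x).PosSemidef

/-- `x` is a (global) optimal solution. -/
def IsOptimal (pr : ConicProgram E J d) (x : E) : Prop :=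
  pr.Feasible x ∧ ∀ y, pr.Feasible y → pr.objective x ≤ pr.objective y

/-- The Lagrangian `f x + ∑ j, u_j g_j x - Tr (Z G x)`. -/
noncomputable def lagrangian [Fintype J] [Fintype d] (pr : ConicProgram E J d)
    (u : J → ℝ) (Z : Matrix d d ℝ) (x : E) : ℝ :=
  pr.objective x + ∑ j, u j * pr.scalar j x - (Z * pr.lmi x).trace

/-- The Karush-Kuhn-Tucker conditions at `x`: primal feasibility, and multipliers with dual
feasibility, complementary slackness and stationarity of the Lagrangian. -/
def IsKKTPoint [Fintype J] [Fintype d] [NormedAddCommGroup E] [NormedSpace ℝ E]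
    (pr : ConicProgram E J d) (x : E) : Prop :=
  pr.Feasible x ∧
    ∃ (u : J → ℝ) (Z : Matrix d d ℝ),
      (∀ j, 0 ≤ u j) ∧ Z.PosSemidef ∧
      (∀ j, u j * pr.scalar j x = 0) ∧ (Z * pr.lmi x).trace = 0 ∧
      HasFDerivAt (pr.lagrangian u Z) (0 : E →L[ℝ] ℝ) x

end ConicProgram

/-- The data at a fixed time step `k`: state dimension `n`, candidate sensors `ι`, and measurement
dimension `m i` of sensor `i`. -/
structure SensorSystem (ι : Type*) (n : ℕ) (m : ι → ℕ) where
  /-- state matrix `A` -/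
  A : Matrix (Fin n) (Fin n) ℝ
  /-- process noise covariance `Q` -/
  Q : Matrix (Fin n) (Fin n) ℝ
  /-- observation matrices `C_i` -/
  C : (i : ι) → Matrix (Fin (m i)) (Fin n) ℝ
  /-- measurement noise covariances `R_i` -/
  R : (i : ι) → Matrix (Fin (m i)) (Fin (m i)) ℝ
  /-- the known error covariance `P_{k-1}` of the previous time step -/
  Pprev : Matrix (Fin n) (Fin n) ℝ
  /-- channel gains `h_k^i` -/
  h : ι → ℝ
  /-- maximum transmission powers `p_max^i` -/
  pmax : ι → ℝ
  /-- SINR requirements `θ_i` -/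
  θ : ι → ℝ
  /-- channel noise `σ²` -/
  σsq : ℝ

/-- The variables `(γ, p, P)` of the relaxed problem. -/
abbrev RelaxedPoint (ι : Type*) (n : ℕ) : Type _ :=
  (ι → ℝ) × (ι → ℝ) × Matrix (Fin n) (Fin n) ℝ

namespace RelaxedPoint

variable {ι : Type*} {n : ℕ}

/-- selection variables -/
abbrev γ (x : RelaxedPoint ι n) : ι → ℝ := x.1
/-- transmission powers -/
abbrev p (x : RelaxedPoint ι n) : ι → ℝ := x.2.1
/-- error covariance -/
abbrev P (x : RelaxedPoint ι n) : Matrix (Fin n) (Fin n) ℝ := x.2.2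

end RelaxedPoint

/-- The variables `(γ, η, p, P)` of the algorithm. -/
abbrev Point (ι : Type*) (n : ℕ) : Type _ :=
  (ι → ℝ) × (ι → ℝ) × (ι → ℝ) × Matrix (Fin n) (Fin n) ℝ

namespace Point

variable {ι : Type*} {n : ℕ}

/-- selection variables -/
abbrev γ (x : Point ι n) : ι → ℝ := x.1
/-- auxiliary interference bounds -/
abbrev η (x : Point ι n) : ι → ℝ := x.2.1
/-- transmission powers -/
abbrev p (x : Point ι n) : ι → ℝ := x.2.2.1
/-- error covariance -/
abbrev P (x : Point ι n) : Matrix (Fin n) (Fin n) ℝ := x.2.2.2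

/-- Forget the auxiliary variable `η`. -/
def toRelaxed (x : Point ι n) : RelaxedPoint ι n := (x.γ, x.p, x.P)

end Point

namespace SensorSystem

variable {ι : Type*} [Fintype ι] {n : ℕ} {m : ι → ℕ}

/-- The prior error covariance `A P_{k-1} Aᵀ + Q`. -/
def priorCov (s : SensorSystem ι n m) : Matrix (Fin n) (Fin n) ℝ :=
  s.A * s.Pprev * s.A.transpose + s.Q

/-- `(A P_{k-1} Aᵀ + Q)⁻¹ + ∑ i, γ_i C_iᵀ R_i⁻¹ C_i`. -/
noncomputable def information (s : SensorSystem ι n m) (γ : ι → ℝ) :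
    Matrix (Fin n) (Fin n) ℝ :=
  s.priorCov⁻¹ + ∑ i, γ i • ((s.C i).transpose * (s.R i)⁻¹ * s.C i)

/-- The block matrix of the linear matrix inequality. -/
noncomputable def block (s : SensorSystem ι n m) (γ : ι → ℝ) (P : Matrix (Fin n) (Fin n) ℝ) :
    Matrix (Fin n ⊕ Fin n) (Fin n ⊕ Fin n) ℝ :=
  Matrix.fromBlocks (s.information γ) 1 1 P

/-- Interference plus noise `∑_{j ≠ i} h_j p_j + σ²` at sensor `i`. -/
def interference [DecidableEq ι] (s : SensorSystem ι n m) (p : ι → ℝ) (i : ι) : ℝ :=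
  ∑ j ∈ Finset.univ.erase i, s.h j * p j + s.σsq

/-- The relaxed problem in the variables `(γ, p, P)`: minimize `Tr P` subject to the linear matrix
inequality, `γ_i θ_i ≤ h_i p_i / (∑_{j ≠ i} h_j p_j + σ²)`, `0 ≤ p_i ≤ p_max^i`, `0 ≤ γ_i ≤ 1`. -/
noncomputable def relaxedProblem [DecidableEq ι] (s : SensorSystem ι n m) :
    ConicProgram (RelaxedPoint ι n) (ι ⊕ ι ⊕ ι ⊕ ι ⊕ ι) (Fin n ⊕ Fin n) where
  objective x := x.P.trace
  scalar :=
    Sum.elim (fun i x => x.γ i * s.θ i - s.h i * x.p i / s.interference x.p i) <|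
    Sum.elim (fun i x => -x.p i) <|
    Sum.elim (fun i x => x.p i - s.pmax i) <|
    Sum.elim (fun i x => -x.γ i) (fun i x => x.γ i - 1)
  lmi x := s.block x.γ x.P

/-- The relaxed problem rewritten with the auxiliary variables `η`: the SINR constraint is
replaced by `∑_{j ≠ i} h_j p_j + σ² ≤ η_i` and `η_i γ_i θ_i ≤ h_i p_i`. -/
noncomputable def liftedProblem [DecidableEq ι] (s : SensorSystem ι n m) :
    ConicProgram (Point ι n) (ι ⊕ ι ⊕ ι ⊕ ι ⊕ ι ⊕ ι) (Fin n ⊕ Fin n) where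
  objective x := x.P.trace
  scalar :=
    Sum.elim (fun i x => s.interference x.p i - x.η i) <|
    Sum.elim (fun i x => x.η i * x.γ i * s.θ i - s.h i * x.p i) <|
    Sum.elim (fun i x => -x.p i) <|
    Sum.elim (fun i x => x.p i - s.pmax i) <|
    Sum.elim (fun i x => -x.γ i) (fun i x => x.γ i - 1)
  lmi x := s.block x.γ x.P

/-- The surrogate problem with parameter `b`: the constraint `η_i γ_i θ_i ≤ h_i p_i` is replaced by
`(η_i + γ_i)² - 2 b_i (η_i - γ_i) + b_i² ≤ (4 / θ_i) h_i p_i`. -/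
noncomputable def surrogateProblem [DecidableEq ι] (s : SensorSystem ι n m) (b : ι → ℝ) :
    ConicProgram (Point ι n) (ι ⊕ ι ⊕ ι ⊕ ι ⊕ ι ⊕ ι) (Fin n ⊕ Fin n) where
  objective x := x.P.trace
  scalar :=
    Sum.elim (fun i x => s.interference x.p i - x.η i) <|
    Sum.elim (fun i x => (x.η i + x.γ i) ^ 2 - 2 * b i * (x.η i - x.γ i) + b i ^ 2
      - 4 / s.θ i * (s.h i * x.p i)) <|
    Sum.elim (fun i x => -x.p i) <|
    Sum.elim (fun i x => x.p i - s.pmax i) <|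
    Sum.elim (fun i x => -x.γ i) (fun i x => x.γ i - 1)
  lmi x := s.block x.γ x.P

/-- One iteration: `y` is an optimal solution of the surrogate problem built at `x`, i.e. with
`b_i = η_i - γ_i` evaluated at `x`. -/
def IsSCAStep [DecidableEq ι] (s : SensorSystem ι n m) (x y : Point ι n) : Prop :=
  (s.surrogateProblem (fun i => x.η i - x.γ i)).IsOptimal y

/-- A run of the SCA-based algorithm from a feasible initial point.  Optimal solutions of the
surrogate problem need not be unique; any of them may be returned. -/
def IsSCARun [DecidableEq ι] (s : SensorSystem ι n m) (x : ℕ → Point ι n) : Prop :=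
  s.liftedProblem.Feasible (x 0) ∧ ∀ t, s.IsSCAStep (x t) (x (t + 1))

end SensorSystem

/-- `z` is a converged solution of the sequence `x`: a cluster point of the iterates (in particular
their limit, if they converge), or an iterate at which the iteration has become stationary. -/
def IsConvergedSolution {E : Type*} [TopologicalSpace E] (x : ℕ → E) (z : E) : Prop :=
  MapClusterPt z atTop x ∨ ∃ t, x t = z ∧ x (t + 1) = z

/-!
The program is convex apart from the bilinear constraint `η_i γ_i θ_i ≤ h_i p_i`, and the matrix
variable enters in a trivial way: by the Schur complement, the linear matrix inequality says
`P ⪰ M(γ)⁻¹`, where `M(γ)` is the information matrix, which is positive definite for `γ ≥ 0`.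
So `P` can be eliminated, at the price of the smooth objective `Tr M(γ)⁻¹`, whose partial
derivatives are `-Tr (M⁻¹ C_iᵀ R_i⁻¹ C_i M⁻¹)` (`SensorSystem.marginalGain`); the multiplier of the
linear matrix inequality is explicit (`SensorSystem.lmiMultiplier`).

The surrogate constraint is `4 η γ + (η - γ - b)² ≤ (4 / θ) h p`.  It implies the original one, and
for `b = η - γ` it agrees with it to first order, up to the factor `4 / θ`.  Hence every iterate is
feasible for its own surrogate problem, and the objective decreases along a run.

Boundedness is the delicate part of the existence of cluster points, because `η` has no a priori
bound and `b` moves with it.  If `η_i` exceeded its previous value, the interference at full power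
and `h_i pmax_i / θ_i`, then lowering `η_i` would create slack in the surrogate constraint, which
could be spent on a larger `γ_i`; as `C_i ≠ 0`, this would strictly lower the objective
(`SensorSystem.eta_le_of_isSCAStep`).

A converged solution `z` is at least as good as each strictly feasible point of the surrogate
problem at `z`: such a point stays feasible for the surrogate problems at iterates near `z`
(`SensorSystem.IsSCARun.trace_le_of_isConvergedSolution`).  Therefore no direction is a descent
direction for `Tr M(γ)⁻¹` that also makes all linearized constraints negative.  Separation of convex
sets turns this into Fritz John multipliers, and a Mangasarian-Fromovitz direction, which exists at
every feasible point, turns these into KKT multipliers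
(`SensorSystem.exists_reduced_multipliers`).  For the relaxed problem, the multiplier `μ_i` of the
bilinear constraint is rescaled to `μ_i D_i(p)`; the assumption on `η_i` is what is needed where
`p_i = 0`.
-/

/-! ### A theorem of the alternative -/

/-- **Fritz John multipliers.** If a linear functional `φ` and finitely many affine functions
`a j + g j` are never negative simultaneously, some nontrivial nonnegative combination of them is
nonnegative everywhere. -/
theorem exists_fritzJohn_multipliers {V J : Type*} [AddCommGroup V] [Module ℝ V] [Fintype J]
    (φ : V →ₗ[ℝ] ℝ) (a : J → ℝ) (g : J → V →ₗ[ℝ] ℝ)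
    (h : ∀ d, (∀ j, a j + g j d < 0) → 0 ≤ φ d) :
    ∃ (u₀ : ℝ) (u : J → ℝ), 0 ≤ u₀ ∧ (∀ j, 0 ≤ u j) ∧ (u₀ = 0 → ∃ j, u j ≠ 0) ∧
      ∀ d, 0 ≤ u₀ * φ d + ∑ j, u j * (a j + g j d) := by
  classical
  let c : V → Option J → ℝ := fun d o => o.elim (φ d) fun j => a j + g j d
  let S : Set (Option J → ℝ) := {v | ∃ d, ∀ o, c d o < v o}
  have hopen : IsOpen S := by
    have : S = ⋃ d, ⋂ o, {v | c d o < v o} := by ext; simp [S]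
    rw [this]
    exact isOpen_iUnion fun d => isOpen_iInter_of_finite fun o =>
      isOpen_lt continuous_const (continuous_apply o)
  have hconv : Convex ℝ S := by
    rintro v ⟨d, hd⟩ w ⟨e, he⟩ p q hp hq hpq
    refine ⟨p • d + q • e, fun o => ?_⟩
    have hc : c (p • d + q • e) o = p * c d o + q * c e o := by
      cases o with
      | none => simp [c]
      | some j =>
        simp only [c, Option.elim_some, map_add, map_smul, smul_eq_mul]
        linear_combination (-a j) * hpq
    have hv := hd o
    have hw := he o
    rw [hc]
    simp only [Pi.add_apply, Pi.smul_apply, smul_eq_mul]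
    rcases hp.eq_or_lt with rfl | hp
    · have : q = 1 := by linarith
      subst this; linarith
    · nlinarith
  have h0 : (0 : Option J → ℝ) ∉ S := by
    rintro ⟨d, hd⟩
    have h1 := hd none
    have h2 := h d fun j => by simpa [c] using hd (some j)
    simp only [c, Option.elim_none, Pi.zero_apply] at h1
    linarith
  obtain ⟨F, hF⟩ := geometric_hahn_banach_point_open hconv hopen h0
  simp only [map_zero] at hF
  have hsum : ∀ v, F v = ∑ o, F (Pi.single o 1) * v o := fun v => by
    conv_lhs => rw [pi_eq_sum_univ' v]
    simp [mul_comm]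
  have hS : ∀ d (v : Option J → ℝ), (∀ o, 0 < v o) → 0 < F (c d + v) := fun d v hv =>
    hF _ ⟨d, fun o => by simpa using hv o⟩
  -- Points of `c d + [0, ∞)^J` are limits of points of `S`.
  have hclosure : ∀ d (w : Option J → ℝ), 0 ≤ w → 0 ≤ F (c d + w) := fun d w hw => by
    have hlim : Tendsto (fun ε : ℝ => F (c d + (w + ε • 1))) (𝓝[>] 0) (𝓝 (F (c d + w))) := by
      have : Continuous fun ε : ℝ => F (c d + (w + ε • 1)) := by fun_prop
      simpa using (this.tendsto 0).mono_left nhdsWithin_le_nhds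
    refine ge_of_tendsto hlim ?_
    filter_upwards [self_mem_nhdsWithin] with ε hε
    refine (hS d _ fun o => ?_).le
    have := hw o
    have hε' : (0 : ℝ) < ε := hε
    simp only [Pi.add_apply, Pi.smul_apply, Pi.one_apply, smul_eq_mul, mul_one, Pi.zero_apply]
      at this ⊢
    linarith
  have hF0 : ∀ o, 0 ≤ F (Pi.single o 1) := fun o => by
    by_contra! hneg
    have hc0 : 0 ≤ F (c 0) := by simpa using hclosure 0 0 le_rfl
    have ht : 0 ≤ (F (c 0) + 1) / -F (Pi.single o 1) :=
      div_nonneg (by linarith) (by linarith)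
    have := hclosure 0 (((F (c 0) + 1) / -F (Pi.single o 1)) • Pi.single o 1)
      (smul_nonneg ht (Pi.single_nonneg.2 zero_le_one))
    rw [map_add, map_smul, smul_eq_mul, div_neg, neg_mul, div_mul_cancel₀ _ hneg.ne] at this
    linarith
  refine ⟨F (Pi.single none 1), fun j => F (Pi.single (some j) 1), hF0 _, fun j => hF0 _, ?_, ?_⟩
  · intro hnone
    by_contra! hall
    have := hS 0 1 (by simp)
    rw [hsum] at this
    simp [hnone, hall] at this
  · intro d
    have := hclosure d 0 le_rfl
    rw [add_zero] at this
    rw [hsum, Fintype.sum_option] at this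
    simpa [c] using this


/-- **Karush-Kuhn-Tucker multipliers.** The multiplier of `φ` can be normalized to `1` as soon as
some direction decreases all active constraints (the Mangasarian-Fromovitz condition). -/
theorem exists_kkt_multipliers {V J : Type*} [AddCommGroup V] [Module ℝ V] [Fintype J]
    (φ : V →ₗ[ℝ] ℝ) (a : J → ℝ) (g : J → V →ₗ[ℝ] ℝ) (ha : ∀ j, a j ≤ 0)
    (h : ∀ d, (∀ j, a j + g j d < 0) → 0 ≤ φ d) (hcq : ∃ d, ∀ j, a j = 0 → g j d < 0) :
    ∃ u : J → ℝ, (∀ j, 0 ≤ u j) ∧ (∀ j, u j * a j = 0) ∧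
      ∀ d, φ d + ∑ j, u j * g j d = 0 := by
  obtain ⟨u₀, u, hu₀, hu, hne, hcomb⟩ := exists_fritzJohn_multipliers φ a g h
  have hle : ∀ j, u j * a j ≤ 0 := fun j => mul_nonpos_of_nonneg_of_nonpos (hu j) (ha j)
  have hcompl : ∀ j, u j * a j = 0 := by
    have h0 := hcomb 0
    simp only [map_zero, mul_zero, add_zero, zero_add] at h0
    have := (Finset.sum_eq_zero_iff_of_nonpos fun j _ => hle j).1
      (le_antisymm (Finset.sum_nonpos fun j _ => hle j) h0)
    exact fun j => this j (Finset.mem_univ j)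
  have hlin : ∀ d, 0 ≤ u₀ * φ d + ∑ j, u j * g j d := fun d => by
    simpa [mul_add, hcompl] using hcomb d
  have hzero : ∀ d, u₀ * φ d + ∑ j, u j * g j d = 0 := fun d => by
    have hneg := hlin (-d)
    simp only [map_neg, mul_neg, Finset.sum_neg_distrib] at hneg
    linarith [hlin d]
  have hu₀_pos : 0 < u₀ := by
    refine lt_of_le_of_ne hu₀ fun h0 => ?_
    obtain ⟨k, hk⟩ := hne h0.symm
    obtain ⟨d, hd⟩ := hcq
    have hterm : ∀ j, u j ≠ 0 → u j * g j d < 0 := fun j hj =>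
      mul_neg_of_pos_of_neg (lt_of_le_of_ne (hu j) (Ne.symm hj))
        (hd j ((mul_eq_zero.1 (hcompl j)).resolve_left hj))
    have hsum : ∑ j, u j * g j d < 0 := by
      refine Finset.sum_neg' (fun j _ => ?_) ⟨k, Finset.mem_univ k, hterm k hk⟩
      by_cases hj : u j = 0
      · simp [hj]
      · exact (hterm j hj).le
    have := hzero d
    rw [← h0] at this
    linarith
  refine ⟨fun j => u j / u₀, fun j => div_nonneg (hu j) hu₀, fun j => ?_, fun d => ?_⟩
  · rw [div_mul_eq_mul_div, hcompl, zero_div]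
  · have := hzero d
    simp only [div_mul_eq_mul_div, ← Finset.sum_div]
    field_simp
    linarith

/-! ### Positive semidefinite matrices -/

namespace Matrix

theorem isClosed_setOf_posSemidef {d : Type*} [Fintype d] :
    IsClosed {M : Matrix d d ℝ | M.PosSemidef} := by
  simp only [posSemidef_iff_dotProduct_mulVec, Set.ofPred_and, Set.ofPred_forall]
  refine IsClosed.inter (isClosed_eq ?_ ?_) (isClosed_iInter fun v => isClosed_le ?_ ?_) <;>
    fun_prop

theorem PosSemidef.abs_apply_le_trace {d : Type*} [Fintype d] [DecidableEq d]
    {M : Matrix d d ℝ} (hM : M.PosSemidef) (i j : d) : |M i j| ≤ M.trace := by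
  have hdiag : ∀ k, M k k ≤ M.trace := fun k =>
    Finset.single_le_sum (f := fun k => M k k) (fun l _ => hM.diag_nonneg) (Finset.mem_univ k)
  have hsymm : M j i = M i j := by simpa using hM.isHermitian.apply i j
  have hplus := hM.dotProduct_mulVec_nonneg (Pi.single i 1 + Pi.single j 1)
  have hminus := hM.dotProduct_mulVec_nonneg (Pi.single i 1 - Pi.single j 1)
  simp [mulVec_add, mulVec_sub, add_dotProduct, sub_dotProduct, hsymm] at hplus hminus
  have := hdiag i
  have := hdiag j
  rw [abs_le]
  constructor <;> linarith

end Matrix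

/-! ### The information matrix and the linear matrix inequality -/

namespace SensorSystem

open Matrix

variable {ι : Type*} {n : ℕ} {m : ι → ℕ}

/-- The information `C_iᵀ R_i⁻¹ C_i` contributed by sensor `i`. -/
noncomputable def sensorInformation (s : SensorSystem ι n m) (i : ι) : Matrix (Fin n) (Fin n) ℝ :=
  (s.C i).transpose * (s.R i)⁻¹ * s.C i

theorem sensorInformation_posSemidef {s : SensorSystem ι n m} (hR : ∀ i, (s.R i).PosDef) (i : ι) :
    (s.sensorInformation i).PosSemidef := by
  have := (hR i).inv.posSemidef.conjTranspose_mul_mul_same (s.C i)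
  rwa [conjTranspose_eq_transpose_of_trivial] at this

variable [Fintype ι]

/-- The derivative of `-Tr M(γ)⁻¹` with respect to `γ_i`, namely `Tr (M⁻¹ C_iᵀ R_i⁻¹ C_i M⁻¹)`,
where `M(γ)` is the information matrix. -/
noncomputable def marginalGain (s : SensorSystem ι n m) (γ : ι → ℝ) (i : ι) : ℝ :=
  ((s.information γ)⁻¹ * s.sensorInformation i * (s.information γ)⁻¹).trace

theorem information_eq (s : SensorSystem ι n m) (γ : ι → ℝ) :
    s.information γ = s.priorCov⁻¹ + ∑ i, γ i • s.sensorInformation i := rfl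

theorem continuous_information (s : SensorSystem ι n m) : Continuous s.information := by
  unfold information
  fun_prop

theorem continuous_block (s : SensorSystem ι n m) :
    Continuous fun x : (ι → ℝ) × Matrix (Fin n) (Fin n) ℝ => s.block x.1 x.2 :=
  (s.continuous_information.comp continuous_fst).matrix_fromBlocks continuous_const
    continuous_const continuous_snd

section PosDef

variable {s : SensorSystem ι n m} (hQ : s.Q.PosSemidef) (hPprev : s.Pprev.PosSemidef)
  (hprior : IsUnit s.priorCov.det) (hR : ∀ i, (s.R i).PosDef)
include hQ hPprev hprior hR

theorem information_posDef {γ : ι → ℝ} (hγ : ∀ i, 0 ≤ γ i) : (s.information γ).PosDef := by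
  have hprior_psd : s.priorCov.PosSemidef := by
    have := (hPprev.mul_mul_conjTranspose_same s.A).add hQ
    rwa [conjTranspose_eq_transpose_of_trivial] at this
  have hprior_pd : s.priorCov.PosDef :=
    hprior_psd.posDef_iff_det_ne_zero.2 hprior.ne_zero
  exact hprior_pd.inv.add_posSemidef
    (posSemidef_sum _ fun i _ => (sensorInformation_posSemidef hR i).smul (hγ i))

theorem block_posSemidef_iff {γ : ι → ℝ} (hγ : ∀ i, 0 ≤ γ i) (P : Matrix (Fin n) (Fin n) ℝ) :
    (s.block γ P).PosSemidef ↔ (P - (s.information γ)⁻¹).PosSemidef := by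
  have hM := information_posDef hQ hPprev hprior hR hγ
  have := hM.isUnit.invertible
  simpa [block] using PosDef.fromBlocks₁₁ (1 : Matrix (Fin n) (Fin n) ℝ) P hM

theorem trace_inv_information_le {γ : ι → ℝ} (hγ : ∀ i, 0 ≤ γ i) {P : Matrix (Fin n) (Fin n) ℝ}
    (hP : (s.block γ P).PosSemidef) : ((s.information γ)⁻¹).trace ≤ P.trace := by
  have := ((block_posSemidef_iff hQ hPprev hprior hR hγ P).1 hP).trace_nonneg
  rw [trace_sub] at this
  linarith

theorem block_inv_posSemidef {γ : ι → ℝ} (hγ : ∀ i, 0 ≤ γ i) :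
    (s.block γ (s.information γ)⁻¹).PosSemidef := by
  rw [block_posSemidef_iff hQ hPprev hprior hR hγ, sub_self]
  exact PosSemidef.zero

theorem tendsto_inv_information {α : Type*} {l : Filter α} {γ : ι → ℝ} (hγ : ∀ i, 0 ≤ γ i)
    {c : α → ι → ℝ} (hc : Tendsto c l (𝓝 γ)) :
    Tendsto (fun a => (s.information (c a))⁻¹) l (𝓝 (s.information γ)⁻¹) := by
  have hdet : (s.information γ).det ≠ 0 :=
    ((isUnit_iff_isUnit_det _).1 (information_posDef hQ hPprev hprior hR hγ).isUnit).ne_zero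
  have hinv : ContinuousAt Inv.inv (s.information γ) := by
    refine continuousAt_matrix_inv _ ?_
    simpa only [Ring.inverse_eq_inv'] using continuousAt_inv₀ hdet
  exact hinv.tendsto.comp ((s.continuous_information.tendsto γ).comp hc)

/-- First-order decrease of `Tr M(γ)⁻¹` along a direction of positive gain, from
`M⁻¹ - M'⁻¹ = M⁻¹ (M' - M) M'⁻¹`. -/
theorem eventually_trace_inv_information_lt {γ d : ι → ℝ} (hγ : ∀ i, 0 ≤ γ i)
    (hd : 0 < ∑ i, d i * s.marginalGain γ i) :
    ∀ᶠ ε : ℝ in 𝓝[>] 0, (∀ i, 0 ≤ γ i + ε * d i) →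
      ((s.information fun i => γ i + ε * d i)⁻¹).trace < ((s.information γ)⁻¹).trace := by
  set N : Matrix (Fin n) (Fin n) ℝ := ∑ i, d i • s.sensorInformation i with hN
  have hc : Tendsto (fun ε : ℝ => fun i => γ i + ε * d i) (𝓝[>] 0) (𝓝 γ) := by
    have : Continuous fun ε : ℝ => fun i => γ i + ε * d i := by fun_prop
    simpa using (this.tendsto 0).mono_left nhdsWithin_le_nhds
  have hgain : ((s.information γ)⁻¹ * N * (s.information γ)⁻¹).trace =
      ∑ i, d i * s.marginalGain γ i := by
    simp [hN, marginalGain, Matrix.mul_sum, Matrix.sum_mul, trace_sum, trace_smul]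
  have hlim : Tendsto (fun ε : ℝ =>
      ((s.information γ)⁻¹ * N * (s.information fun i => γ i + ε * d i)⁻¹).trace) (𝓝[>] 0)
      (𝓝 (∑ i, d i * s.marginalGain γ i)) := by
    rw [← hgain]
    have hcont : Continuous fun X : Matrix (Fin n) (Fin n) ℝ =>
      ((s.information γ)⁻¹ * N * X).trace := by fun_prop
    exact (hcont.tendsto _).comp (tendsto_inv_information hQ hPprev hprior hR hγ hc)
  filter_upwards [hlim.eventually_const_lt hd, self_mem_nhdsWithin] with ε hpos hε hnonneg
  have hM := information_posDef hQ hPprev hprior hR hγ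
  have hM' := information_posDef hQ hPprev hprior hR hnonneg
  set M := s.information γ with hMdef
  set M' := s.information fun i => γ i + ε * d i with hM'def
  have hdiff : M' = M + ε • N := by
    simp [hMdef, hM'def, hN, information_eq, add_smul, mul_smul, Finset.sum_add_distrib,
      Finset.smul_sum, add_assoc]
  have hinv : M⁻¹ - M'⁻¹ = ε • (M⁻¹ * N * M'⁻¹) := by
    have h1 : M⁻¹ * (M' - M) * M'⁻¹ = M⁻¹ - M'⁻¹ := by
      rw [Matrix.mul_sub, Matrix.sub_mul, Matrix.mul_assoc,
        Matrix.mul_nonsing_inv _ ((isUnit_iff_isUnit_det _).1 hM'.isUnit),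
        Matrix.nonsing_inv_mul _ ((isUnit_iff_isUnit_det _).1 hM.isUnit), Matrix.mul_one,
        Matrix.one_mul]
    rw [← h1, hdiff]
    simp
  have htr := congrArg Matrix.trace hinv
  rw [trace_sub, trace_smul, smul_eq_mul] at htr
  have := mul_pos (show (0 : ℝ) < ε from hε) hpos
  linarith

theorem marginalGain_pos {γ : ι → ℝ} (hγ : ∀ i, 0 ≤ γ i) {i : ι} (hC : s.C i ≠ 0) :
    0 < s.marginalGain γ i := by
  have hM := information_posDef hQ hPprev hprior hR hγ
  have hMt : (s.information γ)⁻¹.transpose = (s.information γ)⁻¹ := by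
    simpa [IsHermitian] using hM.inv.isHermitian
  have hdet := (isUnit_iff_isUnit_det _).1 hM.isUnit
  have heq : (s.information γ)⁻¹ * s.sensorInformation i * (s.information γ)⁻¹ =
      (s.C i * (s.information γ)⁻¹)ᴴ * (s.R i)⁻¹ * (s.C i * (s.information γ)⁻¹) := by
    simp [sensorInformation, hMt, Matrix.mul_assoc]
  have hpsd := (hR i).inv.posSemidef.conjTranspose_mul_mul_same (s.C i * (s.information γ)⁻¹)
  rw [marginalGain, heq]
  refine lt_of_le_of_ne hpsd.trace_nonneg fun h0 => hC ?_
  have hzero := hpsd.trace_eq_zero_iff.1 h0.symm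
  have hCM : s.C i * (s.information γ)⁻¹ = 0 := by
    ext a b
    by_contra hne
    have hcol : (s.C i * (s.information γ)⁻¹) *ᵥ Pi.single b 1 ≠ 0 := fun h => hne <| by
      simpa using congrFun h a
    have hpos := (hR i).inv.dotProduct_mulVec_pos hcol
    have hform : star ((s.C i * (s.information γ)⁻¹) *ᵥ Pi.single b 1) ⬝ᵥ
        ((s.R i)⁻¹ *ᵥ ((s.C i * (s.information γ)⁻¹) *ᵥ Pi.single b 1)) =
        star (Pi.single b 1) ⬝ᵥ (((s.C i * (s.information γ)⁻¹)ᴴ * (s.R i)⁻¹ *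
          (s.C i * (s.information γ)⁻¹)) *ᵥ Pi.single b 1) := by
      rw [star_mulVec, ← dotProduct_mulVec, mulVec_mulVec, mulVec_mulVec, Matrix.mul_assoc]
    rw [hform, hzero] at hpos
    simp at hpos
  calc s.C i = s.C i * (s.information γ)⁻¹ * s.information γ := by
        rw [Matrix.mul_assoc, Matrix.nonsing_inv_mul _ hdet, Matrix.mul_one]
    _ = 0 := by rw [hCM, Matrix.zero_mul]

/-- Raising a single selection variable strictly lowers `Tr M(γ)⁻¹`. -/
theorem eventually_trace_inv_information_update_lt [DecidableEq ι] {γ : ι → ℝ}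
    (hγ : ∀ i, 0 ≤ γ i) {i : ι} (hC : s.C i ≠ 0) :
    ∀ᶠ ε : ℝ in 𝓝[>] 0,
      ((s.information (Function.update γ i (γ i + ε)))⁻¹).trace <
        ((s.information γ)⁻¹).trace := by
  have hd : 0 < ∑ j, (Pi.single i 1 : ι → ℝ) j * s.marginalGain γ j := by
    simpa [Pi.single_apply] using marginalGain_pos hQ hPprev hprior hR hγ hC
  filter_upwards [eventually_trace_inv_information_lt hQ hPprev hprior hR hγ hd,
    self_mem_nhdsWithin] with ε hlt hε
  have hupd : (fun j => γ j + ε * (Pi.single i 1 : ι → ℝ) j) =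
      Function.update γ i (γ i + ε) := by
    ext j
    by_cases hj : j = i
    · subst hj; simp
    · simp [hj]
  rw [← hupd]
  refine hlt fun j => ?_
  have : 0 ≤ (Pi.single i 1 : ι → ℝ) j := by
    by_cases hj : j = i
    · subst hj; simp
    · simp [hj]
  have := mul_nonneg (show (0 : ℝ) ≤ ε from le_of_lt hε) this
  linarith [hγ j]

end PosDef

/-- The multiplier `[[M⁻², -M⁻¹], [-M⁻¹, 1]]` of the linear matrix inequality, where `M` is the
information matrix at `γ`. -/
noncomputable def lmiMultiplier (s : SensorSystem ι n m) (γ : ι → ℝ) :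
    Matrix (Fin n ⊕ Fin n) (Fin n ⊕ Fin n) ℝ :=
  fromBlocks ((s.information γ)⁻¹ * (s.information γ)⁻¹) (-(s.information γ)⁻¹)
    (-(s.information γ)⁻¹) 1

theorem lmiMultiplier_posSemidef {s : SensorSystem ι n m} {γ : ι → ℝ}
    (hM : (s.information γ).PosDef) : (s.lmiMultiplier γ).PosSemidef := by
  have hMt : (s.information γ)⁻¹ᴴ = (s.information γ)⁻¹ := hM.inv.isHermitian
  have := posSemidef_conjTranspose_mul_self
    (fromCols (-(s.information γ)⁻¹) (1 : Matrix (Fin n) (Fin n) ℝ))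
  rw [conjTranspose_fromCols_eq_fromRows_conjTranspose, fromRows_mul_fromCols] at this
  simpa only [lmiMultiplier, conjTranspose_neg, hMt, conjTranspose_one, neg_mul_neg, Matrix.mul_one,
    Matrix.one_mul] using this

/-- The pairing of the matrix multiplier with the matrix constraint is affine, with slope
`Tr P` in `P` and slope the marginal gains in `γ`. -/
theorem trace_lmiMultiplier_mul_block {s : SensorSystem ι n m} {γ : ι → ℝ}
    (hM : (s.information γ).PosDef) (c : ι → ℝ) (P : Matrix (Fin n) (Fin n) ℝ) :
    (s.lmiMultiplier γ * s.block c P).trace =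
      P.trace - ((s.information γ)⁻¹).trace + ∑ i, (c i - γ i) * s.marginalGain γ i := by
  have hdet := (isUnit_iff_isUnit_det _).1 hM.isUnit
  have hc : s.information c = s.information γ + ∑ i, (c i - γ i) • s.sensorInformation i := by
    simp [information_eq, sub_smul, add_assoc]
  have hgain : ∀ i, ((s.information γ)⁻¹ * (s.information γ)⁻¹ * s.sensorInformation i).trace =
      s.marginalGain γ i := fun i => by
    rw [marginalGain, Matrix.mul_assoc, Matrix.trace_mul_comm]
  have hself : (s.information γ)⁻¹ * (s.information γ)⁻¹ * s.information γ =
      (s.information γ)⁻¹ := by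
    rw [Matrix.mul_assoc, Matrix.nonsing_inv_mul _ hdet, Matrix.mul_one]
  have hblocks : ∀ W X Y Z : Matrix (Fin n) (Fin n) ℝ,
      (fromBlocks W X Y Z).trace = W.trace + Z.trace := fun W X Y Z => by
    simp [Matrix.trace, Fintype.sum_sum_type]
  simp only [lmiMultiplier, block, fromBlocks_multiply, hblocks, Matrix.mul_one,
    Matrix.one_mul, hc, Matrix.mul_add, Matrix.mul_sum, mul_smul_comm, trace_add, trace_sum,
    trace_smul, hgain, hself, trace_neg, smul_eq_mul]
  ring

end SensorSystem

/-! ### Feasible sets -/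

namespace SensorSystem

variable {ι : Type*} [Fintype ι] [DecidableEq ι] {n : ℕ} {m : ι → ℕ} {s : SensorSystem ι n m}

theorem relaxedProblem_feasible_iff {x : RelaxedPoint ι n} :
    s.relaxedProblem.Feasible x ↔
      ((∀ i, x.γ i * s.θ i ≤ s.h i * x.p i / s.interference x.p i) ∧ (∀ i, 0 ≤ x.p i) ∧
        (∀ i, x.p i ≤ s.pmax i) ∧ (∀ i, 0 ≤ x.γ i) ∧ ∀ i, x.γ i ≤ 1) ∧
      (s.block x.γ x.P).PosSemidef := by
  simp [ConicProgram.Feasible, relaxedProblem]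

theorem liftedProblem_feasible_iff {x : Point ι n} :
    s.liftedProblem.Feasible x ↔
      ((∀ i, s.interference x.p i ≤ x.η i) ∧ (∀ i, x.η i * x.γ i * s.θ i ≤ s.h i * x.p i) ∧
        (∀ i, 0 ≤ x.p i) ∧ (∀ i, x.p i ≤ s.pmax i) ∧ (∀ i, 0 ≤ x.γ i) ∧ ∀ i, x.γ i ≤ 1) ∧
      (s.block x.γ x.P).PosSemidef := by
  simp [ConicProgram.Feasible, liftedProblem]

theorem surrogateProblem_feasible_iff {b : ι → ℝ} {x : Point ι n} :
    (s.surrogateProblem b).Feasible x ↔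
      ((∀ i, s.interference x.p i ≤ x.η i) ∧
        (∀ i, (x.η i + x.γ i) ^ 2 - 2 * b i * (x.η i - x.γ i) + b i ^ 2 ≤
          4 / s.θ i * (s.h i * x.p i)) ∧
        (∀ i, 0 ≤ x.p i) ∧ (∀ i, x.p i ≤ s.pmax i) ∧ (∀ i, 0 ≤ x.γ i) ∧ ∀ i, x.γ i ≤ 1) ∧
      (s.block x.γ x.P).PosSemidef := by
  simp [ConicProgram.Feasible, surrogateProblem]

omit [Fintype ι] [DecidableEq ι] in
/-- The gap between the quadratic upper bound and `4 η γ` is `(η - γ - b)²`. -/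
theorem surrogate_quadratic_eq (η γ b : ℝ) :
    (η + γ) ^ 2 - 2 * b * (η - γ) + b ^ 2 = 4 * (η * γ) + (η - γ - b) ^ 2 := by ring

theorem surrogate_feasible_self (hθ : ∀ i, 0 < s.θ i) {x : Point ι n}
    (hx : s.liftedProblem.Feasible x) :
    (s.surrogateProblem fun i => x.η i - x.γ i).Feasible x := by
  rw [liftedProblem_feasible_iff] at hx
  rw [surrogateProblem_feasible_iff]
  obtain ⟨⟨h1, h2, h3⟩, h4⟩ := hx
  refine ⟨⟨h1, fun i => ?_, h3⟩, h4⟩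
  rw [surrogate_quadratic_eq, sub_self, div_mul_eq_mul_div, le_div_iff₀ (hθ i)]
  nlinarith [h2 i]

theorem lifted_feasible_of_surrogate (hθ : ∀ i, 0 < s.θ i) {b : ι → ℝ} {x : Point ι n}
    (hx : (s.surrogateProblem b).Feasible x) : s.liftedProblem.Feasible x := by
  rw [surrogateProblem_feasible_iff] at hx
  rw [liftedProblem_feasible_iff]
  obtain ⟨⟨h1, h2, h3⟩, h4⟩ := hx
  refine ⟨⟨h1, fun i => ?_, h3⟩, h4⟩
  have := h2 i
  rw [surrogate_quadratic_eq, div_mul_eq_mul_div, le_div_iff₀ (hθ i)] at this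
  nlinarith [mul_nonneg (sq_nonneg (x.η i - x.γ i - b i)) (hθ i).le]

theorem interference_pos (hh : ∀ i, 0 < s.h i) (hσ : 0 < s.σsq) {p : ι → ℝ} (hp : ∀ i, 0 ≤ p i)
    (i : ι) : 0 < s.interference p i :=
  add_pos_of_nonneg_of_pos (Finset.sum_nonneg fun j _ => mul_nonneg (hh j).le (hp j)) hσ

theorem interference_mono (hh : ∀ i, 0 < s.h i) {p q : ι → ℝ} (hpq : ∀ i, p i ≤ q i) (i : ι) :
    s.interference p i ≤ s.interference q i := by
  unfold interference
  gcongr with j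
  · exact (hh j).le
  · exact hpq j

theorem relaxed_feasible_of_lifted (hh : ∀ i, 0 < s.h i) (hθ : ∀ i, 0 < s.θ i) (hσ : 0 < s.σsq)
    {x : Point ι n} (hx : s.liftedProblem.Feasible x) :
    s.relaxedProblem.Feasible x.toRelaxed := by
  rw [liftedProblem_feasible_iff] at hx
  rw [relaxedProblem_feasible_iff]
  obtain ⟨⟨h1, h2, h3, h4, h5, h6⟩, h7⟩ := hx
  refine ⟨⟨fun i => ?_, h3, h4, h5, h6⟩, h7⟩
  have hD := interference_pos hh hσ h3 i
  change x.γ i * s.θ i ≤ s.h i * x.p i / s.interference x.p i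
  rw [le_div_iff₀ hD]
  nlinarith [h2 i, mul_le_mul_of_nonneg_right (h1 i) (mul_nonneg (h5 i) (hθ i).le)]

@[fun_prop]
theorem continuous_interference (i : ι) : Continuous fun p => s.interference p i := by
  unfold interference
  fun_prop

omit [DecidableEq ι] in
theorem continuous_lmi : Continuous fun x : Point ι n => s.block x.γ x.P :=
  s.continuous_block.comp (continuous_fst.prodMk continuous_snd.snd.snd)

theorem continuous_surrogate_scalar (j : ι ⊕ ι ⊕ ι ⊕ ι ⊕ ι ⊕ ι) :
    Continuous fun y : (ι → ℝ) × Point ι n => (s.surrogateProblem y.1).scalar j y.2 := by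
  have hD : ∀ i, Continuous fun y : (ι → ℝ) × Point ι n => s.interference y.2.p i := fun i =>
    (continuous_interference i).comp (by fun_prop)
  rcases j with i | i | i | i | i | i <;>
    simp only [surrogateProblem, Sum.elim_inl, Sum.elim_inr] <;> fun_prop

theorem continuous_lifted_scalar (j : ι ⊕ ι ⊕ ι ⊕ ι ⊕ ι ⊕ ι) :
    Continuous fun x : Point ι n => s.liftedProblem.scalar j x := by
  have hD : ∀ i, Continuous fun x : Point ι n => s.interference x.p i := fun i =>
    (continuous_interference i).comp (by fun_prop)
  rcases j with i | i | i | i | i | i <;>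
    simp only [liftedProblem, Sum.elim_inl, Sum.elim_inr] <;> fun_prop

theorem isClosed_lifted_feasible : IsClosed {x : Point ι n | s.liftedProblem.Feasible x} := by
  have hset : {x : Point ι n | s.liftedProblem.Feasible x} =
      (⋂ j, {x | s.liftedProblem.scalar j x ≤ 0}) ∩
        (fun x => s.block x.γ x.P) ⁻¹' {M | M.PosSemidef} := by
    ext x
    simp [ConicProgram.Feasible, liftedProblem]
  rw [hset]
  exact (isClosed_iInter fun j => isClosed_le (continuous_lifted_scalar j) continuous_const).inter
    (Matrix.isClosed_setOf_posSemidef.preimage continuous_lmi)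

theorem isClosed_surrogate_feasible (b : ι → ℝ) :
    IsClosed {x : Point ι n | (s.surrogateProblem b).Feasible x} := by
  have hset : {x : Point ι n | (s.surrogateProblem b).Feasible x} =
      (⋂ j, {x | (s.surrogateProblem b).scalar j x ≤ 0}) ∩
        (fun x => s.block x.γ x.P) ⁻¹' {M | M.PosSemidef} := by
    ext x
    simp [ConicProgram.Feasible, surrogateProblem]
  rw [hset]
  exact (isClosed_iInter fun j => isClosed_le
    ((continuous_surrogate_scalar j).comp (by fun_prop : Continuous fun x : Point ι n => (b, x)))
    continuous_const).inter
    (Matrix.isClosed_setOf_posSemidef.preimage continuous_lmi)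

omit [Fintype ι] [DecidableEq ι] in
theorem continuous_trace_P : Continuous fun x : Point ι n => x.P.trace :=
  (continuous_snd.snd.snd).matrix_trace

omit [DecidableEq ι] in
theorem posSemidef_of_block {γ : ι → ℝ} {P : Matrix (Fin n) (Fin n) ℝ}
    (h : (s.block γ P).PosSemidef) : P.PosSemidef := h.submatrix Sum.inr

/-! ### Boundedness and existence of optimal solutions -/

omit [DecidableEq ι] in
/-- The entries of `P ⪰ 0` are bounded by its trace, so a bound on `η` and on the objective is
all that the constraints leave open. -/
theorem isBounded_of_bounds (H T : ℝ) :
    Bornology.IsBounded {x : Point ι n | (∀ i, 0 ≤ x.γ i ∧ x.γ i ≤ 1) ∧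
      (∀ i, 0 ≤ x.p i ∧ x.p i ≤ s.pmax i) ∧ (∀ i, |x.η i| ≤ H) ∧ x.P.PosSemidef ∧
      x.P.trace ≤ T} := by
  set r : ℝ := 1 + |H| + |T| + ∑ i, |s.pmax i| with hr
  have hsum : 0 ≤ ∑ i, |s.pmax i| := Finset.sum_nonneg fun i _ => abs_nonneg _
  have hH := le_abs_self H
  have hT := le_abs_self T
  have hH0 := abs_nonneg H
  have hT0 := abs_nonneg T
  have hr0 : 0 ≤ r := by positivity
  refine (Metric.isBounded_closedBall (x := (0 : Point ι n)) (r := r)).subset ?_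
  rintro x ⟨hγ, hp, hη, hP, htr⟩
  rw [mem_closedBall_zero_iff, norm_prod_le_iff, norm_prod_le_iff, norm_prod_le_iff,
    pi_norm_le_iff_of_nonneg hr0, pi_norm_le_iff_of_nonneg hr0, pi_norm_le_iff_of_nonneg hr0,
    Matrix.norm_le_iff hr0]
  refine ⟨fun i => ?_, fun i => ?_, fun i => ?_, fun i j => ?_⟩
  · rw [Real.norm_eq_abs, abs_of_nonneg (hγ i).1]
    linarith [(hγ i).2]
  · rw [Real.norm_eq_abs]
    linarith [hη i]
  · rw [Real.norm_eq_abs, abs_of_nonneg (hp i).1]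
    have := Finset.single_le_sum (f := fun i => |s.pmax i|) (fun i _ => abs_nonneg _)
      (Finset.mem_univ i)
    have := le_abs_self (s.pmax i)
    linarith [(hp i).2]
  · rw [Real.norm_eq_abs]
    linarith [hP.abs_apply_le_trace i j]

theorem exists_isSCAStep (hh : ∀ i, 0 < s.h i) (hθ : ∀ i, 0 < s.θ i) (hσ : 0 < s.σsq)
    {x : Point ι n} (hx : s.liftedProblem.Feasible x) : ∃ y, s.IsSCAStep x y := by
  set b : ι → ℝ := fun i => x.η i - x.γ i with hb
  have hxs := surrogate_feasible_self hθ hx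
  set K : Set (Point ι n) := {y | (s.surrogateProblem b).Feasible y ∧ y.P.trace ≤ x.P.trace}
    with hK
  set H : ℝ := ∑ i, (4 / s.θ i * (s.h i * s.pmax i) + 2 + |b i|) with hH
  have hbdd : Bornology.IsBounded K := by
    refine (isBounded_of_bounds (s := s) H x.P.trace).subset ?_
    rintro y ⟨hy, hytr⟩
    rw [surrogateProblem_feasible_iff] at hy
    obtain ⟨⟨h1, h2, h3, h4, h5, h6⟩, h7⟩ := hy
    refine ⟨fun i => ⟨h5 i, h6 i⟩, fun i => ⟨h3 i, h4 i⟩, fun i => ?_, posSemidef_of_block h7,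
      hytr⟩
    have hη : ∀ i, 0 < y.η i := fun i => (interference_pos hh hσ h3 i).trans_le (h1 i)
    -- `(η - γ - b)² ≤ B` and `0 ≤ γ ≤ 1` give `η ≤ (B + 1) + 1 + |b|`.
    have hterm : ∀ i, y.η i ≤ 4 / s.θ i * (s.h i * s.pmax i) + 2 + |b i| := fun i => by
      have hq := h2 i
      rw [surrogate_quadratic_eq] at hq
      have hB : 4 / s.θ i * (s.h i * y.p i) ≤ 4 / s.θ i * (s.h i * s.pmax i) := by
        have := (hθ i).le
        have := (hh i).le
        gcongr
        exact h4 i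
      have := mul_nonneg (hη i).le (h5 i)
      have := le_abs_self (b i)
      nlinarith [h6 i, sq_nonneg (y.η i - y.γ i - b i - 1)]
    rw [abs_of_pos (hη i)]
    exact (hterm i).trans (Finset.single_le_sum
      (f := fun i => 4 / s.θ i * (s.h i * s.pmax i) + 2 + |b i|)
      (fun j _ => (hη j).le.trans (hterm j)) (Finset.mem_univ i))
  have hclosed : IsClosed K :=
    (isClosed_surrogate_feasible b).inter (isClosed_le continuous_trace_P continuous_const)
  have : ProperSpace (Point ι n) := FiniteDimensional.proper ℝ _
  obtain ⟨y, hyK, hy⟩ := (Metric.isCompact_of_isClosed_isBounded hclosed hbdd).exists_isMinOn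
    ⟨x, hxs, le_rfl⟩ continuous_trace_P.continuousOn
  refine ⟨y, hyK.1, fun w hw => ?_⟩
  by_cases hwx : w.P.trace ≤ x.P.trace
  · exact hy ⟨hw, hwx⟩
  · exact hyK.2.trans (not_le.1 hwx).le

/-- At an optimal solution of a surrogate problem, `η_i` is below its old value unless it is
tight (`η_i = D_i(p)`) or `γ_i = 1`.  Otherwise `η_i` could be lowered, which makes room for a
larger `γ_i`, and since `C_i ≠ 0` this lowers the objective. -/
theorem eta_le_of_isSCAStep (hQ : s.Q.PosSemidef) (hPprev : s.Pprev.PosSemidef)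
    (hprior : IsUnit s.priorCov.det) (hR : ∀ i, (s.R i).PosDef) (hC : ∀ i, s.C i ≠ 0)
    (hh : ∀ i, 0 < s.h i) (hθ : ∀ i, 0 < s.θ i)
    {x y : Point ι n} (hx : s.liftedProblem.Feasible x) (hxy : s.IsSCAStep x y) (i : ι) :
    y.η i ≤ max (x.η i) (max (s.interference s.pmax i) (s.h i * s.pmax i / s.θ i)) := by
  obtain ⟨hy, hopt⟩ := hxy
  have hylift := lifted_feasible_of_surrogate hθ hy
  rw [liftedProblem_feasible_iff] at hx hylift
  have hxγ := hx.1.2.2.2.2.1 i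
  have hyprod := hylift.1.2.1 i
  rw [surrogateProblem_feasible_iff] at hy
  obtain ⟨⟨h1, h2, h3, h4, h5, h6⟩, h7⟩ := hy
  by_contra! hlt
  simp only [max_lt_iff] at hlt
  obtain ⟨hηx, hηD, hηp⟩ := hlt
  have hD : s.interference y.p i < y.η i := (interference_mono hh h4 i).trans_lt hηD
  have hγ1 : y.γ i < 1 := by
    refine lt_of_le_of_ne (h6 i) fun h => ?_
    rw [h, mul_one] at hyprod
    rw [div_lt_iff₀ (hθ i)] at hηp
    have := mul_le_mul_of_nonneg_left (h4 i) (hh i).le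
    linarith
  set b : ι → ℝ := fun i => x.η i - x.γ i with hb
  have hηb : b i < y.η i := by simp only [hb]; linarith
  -- Lowering `η_i` by `t` changes the quadratic bound by `t (t - 2 (η_i + γ_i - b_i)) < 0`.
  obtain ⟨t, ht0, htD, htb⟩ : ∃ t, 0 < t ∧ t ≤ y.η i - s.interference y.p i ∧
      t ≤ y.η i - b i :=
    ⟨min (y.η i - s.interference y.p i) (y.η i - b i), by
      rw [lt_min_iff]; constructor <;> linarith, min_le_left _ _, min_le_right _ _⟩
  have hslack : (y.η i - t + y.γ i) ^ 2 - 2 * b i * (y.η i - t - y.γ i) + b i ^ 2 <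
      4 / s.θ i * (s.h i * y.p i) := by
    have := h2 i
    nlinarith [h5 i, mul_pos ht0 (show 0 < 2 * (y.η i + y.γ i - b i) - t by
      linarith [h5 i])]
  have hev1 : ∀ᶠ ε : ℝ in 𝓝[>] 0, (y.η i - t + (y.γ i + ε)) ^ 2 -
      2 * b i * (y.η i - t - (y.γ i + ε)) + b i ^ 2 < 4 / s.θ i * (s.h i * y.p i) := by
    have hcont : Continuous fun ε : ℝ => (y.η i - t + (y.γ i + ε)) ^ 2 -
      2 * b i * (y.η i - t - (y.γ i + ε)) + b i ^ 2 := by fun_prop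
    exact ((hcont.tendsto 0).mono_left nhdsWithin_le_nhds).eventually_lt_const
      (by simpa using hslack)
  have hev2 : ∀ᶠ ε : ℝ in 𝓝[>] 0, y.γ i + ε < 1 := by
    have hcont : Continuous fun ε : ℝ => y.γ i + ε := by fun_prop
    exact ((hcont.tendsto 0).mono_left nhdsWithin_le_nhds).eventually_lt_const
      (by simpa using hγ1)
  obtain ⟨ε, hε1, hε2, hε3, hε0⟩ := (hev1.and (hev2.and
    ((eventually_trace_inv_information_update_lt hQ hPprev hprior hR h5 (hC i)).and
      self_mem_nhdsWithin))).exists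
  have hε0' : (0 : ℝ) < ε := hε0
  have hγ' : ∀ j, 0 ≤ Function.update y.γ i (y.γ i + ε) j := fun j => by
    by_cases hj : j = i
    · subst hj; simp; linarith [h5 j]
    · simpa [hj] using h5 j
  have hle := hopt (Function.update y.γ i (y.γ i + ε), Function.update y.η i (y.η i - t), y.p,
      (s.information (Function.update y.γ i (y.γ i + ε)))⁻¹) (by
    rw [surrogateProblem_feasible_iff]
    refine ⟨⟨fun j => ?_, fun j => ?_, h3, h4, hγ', fun j => ?_⟩,
      block_inv_posSemidef hQ hPprev hprior hR hγ'⟩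
    · change s.interference y.p j ≤ Function.update y.η i (y.η i - t) j
      by_cases hj : j = i
      · subst hj; simp; linarith
      · simpa [hj] using h1 j
    · change (Function.update y.η i (y.η i - t) j + Function.update y.γ i (y.γ i + ε) j) ^ 2 -
        2 * b j * (Function.update y.η i (y.η i - t) j - Function.update y.γ i (y.γ i + ε) j) +
        b j ^ 2 ≤ 4 / s.θ j * (s.h j * y.p j)
      by_cases hj : j = i
      · subst hj; simpa using hε1.le
      · simpa [hj] using h2 j
    · change Function.update y.γ i (y.γ i + ε) j ≤ 1
      by_cases hj : j = i
      · subst hj; simpa using hε2.le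
      · simpa [hj] using h6 j)
  have hle' : y.P.trace ≤ ((s.information (Function.update y.γ i (y.γ i + ε)))⁻¹).trace := hle
  linarith [trace_inv_information_le hQ hPprev hprior hR h5 h7]

end SensorSystem

/-! ### Derivatives of the constraints -/

namespace SensorSystem

variable {ι : Type*} {n : ℕ} {m : ι → ℕ} {s : SensorSystem ι n m}

/-- The coordinate `γ_i` as a linear functional. -/
noncomputable def coordγ (n : ℕ) (i : ι) : Point ι n →L[ℝ] ℝ :=
  (ContinuousLinearMap.proj i).comp (ContinuousLinearMap.fst ℝ _ _)

/-- The coordinate `η_i` as a linear functional. -/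
noncomputable def coordη (n : ℕ) (i : ι) : Point ι n →L[ℝ] ℝ :=
  (ContinuousLinearMap.proj i).comp
    ((ContinuousLinearMap.fst ℝ _ _).comp (ContinuousLinearMap.snd ℝ _ _))

/-- The coordinate `p_i` as a linear functional. -/
noncomputable def coordp (n : ℕ) (i : ι) : Point ι n →L[ℝ] ℝ :=
  (ContinuousLinearMap.proj i).comp ((ContinuousLinearMap.fst ℝ _ _).comp
    ((ContinuousLinearMap.snd ℝ _ _).comp (ContinuousLinearMap.snd ℝ _ _)))

@[simp] theorem coordγ_apply (i : ι) (d : Point ι n) : coordγ n i d = d.γ i := rfl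
@[simp] theorem coordη_apply (i : ι) (d : Point ι n) : coordη n i d = d.η i := rfl
@[simp] theorem coordp_apply (i : ι) (d : Point ι n) : coordp n i d = d.p i := rfl

theorem hasFDerivAt_γ (i : ι) (z : Point ι n) :
    HasFDerivAt (fun x : Point ι n => x.γ i) (coordγ n i) z := (coordγ n i).hasFDerivAt
theorem hasFDerivAt_η (i : ι) (z : Point ι n) :
    HasFDerivAt (fun x : Point ι n => x.η i) (coordη n i) z := (coordη n i).hasFDerivAt
theorem hasFDerivAt_p (i : ι) (z : Point ι n) :
    HasFDerivAt (fun x : Point ι n => x.p i) (coordp n i) z := (coordp n i).hasFDerivAt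

variable [Fintype ι] [DecidableEq ι]

/-- The linear part `∑_{j ≠ i} h_j p_j` of the interference. -/
noncomputable def interferenceLin (s : SensorSystem ι n m) (i : ι) : Point ι n →L[ℝ] ℝ :=
  ∑ j ∈ Finset.univ.erase i, s.h j • coordp n j

theorem interferenceLin_apply (i : ι) (d : Point ι n) :
    s.interferenceLin i d = ∑ j ∈ Finset.univ.erase i, s.h j * d.p j := by
  simp only [interferenceLin, _root_.sum_apply, _root_.smul_apply,
    coordp_apply, smul_eq_mul]

theorem interference_eq (x : Point ι n) (i : ι) :
    s.interference x.p i = s.interferenceLin i x + s.σsq := by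
  rw [interferenceLin_apply, interference]

theorem hasFDerivAt_interference (i : ι) (z : Point ι n) :
    HasFDerivAt (fun x : Point ι n => s.interference x.p i) (s.interferenceLin i) z := by
  simp only [interference_eq]
  exact (s.interferenceLin i).hasFDerivAt.add_const _

/-- The derivatives at `z` of the scalar constraints of the lifted problem. -/
noncomputable def liftedDeriv (s : SensorSystem ι n m) (z : Point ι n) :
    ι ⊕ ι ⊕ ι ⊕ ι ⊕ ι ⊕ ι → Point ι n →L[ℝ] ℝ :=
  Sum.elim (fun i => s.interferenceLin i - coordη n i) <|
  Sum.elim (fun i => s.θ i • (z.η i • coordγ n i + z.γ i • coordη n i) - s.h i • coordp n i) <|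
  Sum.elim (fun i => -coordp n i) <|
  Sum.elim (fun i => coordp n i) <|
  Sum.elim (fun i => -coordγ n i) (fun i => coordγ n i)

theorem hasFDerivAt_lifted_scalar (z : Point ι n) (j : ι ⊕ ι ⊕ ι ⊕ ι ⊕ ι ⊕ ι) :
    HasFDerivAt (s.liftedProblem.scalar j) (s.liftedDeriv z j) z := by
  rcases j with i | i | i | i | i | i
  · exact (hasFDerivAt_interference i z).sub (hasFDerivAt_η i z)
  · exact (((hasFDerivAt_η i z).mul (hasFDerivAt_γ i z)).mul_const (s.θ i)).sub
      ((hasFDerivAt_p i z).const_mul (s.h i))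
  · exact (hasFDerivAt_p i z).neg
  · exact (hasFDerivAt_p i z).sub_const _
  · exact (hasFDerivAt_γ i z).neg
  · exact (hasFDerivAt_γ i z).sub_const _

/-- The derivatives at `z` of the scalar constraints of the relaxed problem, as functionals on
the lifted space (they ignore `η`). -/
noncomputable def relaxedDeriv (s : SensorSystem ι n m) (z : Point ι n) :
    ι ⊕ ι ⊕ ι ⊕ ι ⊕ ι → Point ι n →L[ℝ] ℝ :=
  Sum.elim (fun i => s.θ i • coordγ n i -
    ((s.h i / s.interference z.p i) • coordp n i -
      (s.h i * z.p i / s.interference z.p i ^ 2) • s.interferenceLin i)) <|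
  Sum.elim (fun i => -coordp n i) <|
  Sum.elim (fun i => coordp n i) <|
  Sum.elim (fun i => -coordγ n i) (fun i => coordγ n i)

theorem hasFDerivAt_relaxed_scalar {z : Point ι n} (hD : ∀ i, s.interference z.p i ≠ 0)
    (j : ι ⊕ ι ⊕ ι ⊕ ι ⊕ ι) :
    HasFDerivAt (fun x : Point ι n => s.relaxedProblem.scalar j x.toRelaxed)
      (s.relaxedDeriv z j) z := by
  rcases j with i | i | i | i | i
  · have hquot := ((hasFDerivAt_p i z).const_mul (s.h i)).mul
      ((hasDerivAt_inv (hD i)).comp_hasFDerivAt z (hasFDerivAt_interference i z))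
    simp only [relaxedProblem, Sum.elim_inl, div_eq_mul_inv]
    refine (((hasFDerivAt_γ i z).mul_const (s.θ i)).sub hquot).congr_fderiv ?_
    refine ContinuousLinearMap.ext fun d => ?_
    have := hD i
    change s.θ i * d.γ i - (s.h i * z.p i * (-(s.interference z.p i ^ 2)⁻¹ * s.interferenceLin i d) +
      (s.interference z.p i)⁻¹ * (s.h i * d.p i)) = s.θ i * d.γ i -
        (s.h i / s.interference z.p i * d.p i -
          s.h i * z.p i / s.interference z.p i ^ 2 * s.interferenceLin i d)
    field_simp
    ring
  · exact (hasFDerivAt_p i z).neg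
  · exact (hasFDerivAt_p i z).sub_const _
  · exact (hasFDerivAt_γ i z).neg
  · exact (hasFDerivAt_γ i z).sub_const _

/-- The embedding `(γ, p, P) ↦ (γ, 0, p, P)`. -/
noncomputable def embedRelaxed (ι : Type*) [Fintype ι] (n : ℕ) :
    RelaxedPoint ι n →L[ℝ] Point ι n :=
  (ContinuousLinearMap.fst ℝ _ _).prod
    ((0 : RelaxedPoint ι n →L[ℝ] ι → ℝ).prod (ContinuousLinearMap.snd ℝ _ _))

/-! ### First-order optimality -/

/-- The first-order change of `Tr M(γ)⁻¹`, the objective with `P` eliminated. -/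
noncomputable def reducedDeriv (s : SensorSystem ι n m) (γ : ι → ℝ) : Point ι n →L[ℝ] ℝ :=
  -∑ i, s.marginalGain γ i • coordγ n i

omit [DecidableEq ι] in
theorem reducedDeriv_apply (γ : ι → ℝ) (d : Point ι n) :
    s.reducedDeriv γ d = -∑ i, s.marginalGain γ i * d.γ i := by
  rw [reducedDeriv, _root_.neg_apply, _root_.sum_apply]
  rfl

/-- A direction along which all linearized constraints of the lifted problem become negative leads
to strictly feasible points of the surrogate problem: at `z` the surrogate constraint agrees with
`4 / θ_i` times the lifted one to first order. -/
theorem eventually_surrogate_scalar_neg (hθ : ∀ i, 0 < s.θ i) {z : Point ι n}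
    (hz : s.liftedProblem.Feasible z) {d : Point ι n}
    (hd : ∀ j, s.liftedProblem.scalar j z + s.liftedDeriv z j d < 0) :
    ∀ᶠ ε : ℝ in 𝓝[>] 0, ∀ j,
      (s.surrogateProblem fun i => z.η i - z.γ i).scalar j (z + ε • d) < 0 := by
  have hle1 : ∀ᶠ ε : ℝ in 𝓝[>] 0, ε < 1 :=
    (eventually_lt_nhds zero_lt_one).filter_mono nhdsWithin_le_nhds
  have haff : ∀ {ε a g : ℝ}, 0 < ε → ε < 1 → a ≤ 0 → a + g < 0 → a + ε * g < 0 := by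
    intro ε a g h0 h1 ha hag
    nlinarith
  rw [eventually_all]
  intro j
  have ha := hz.1 j
  have hdj := hd j
  rcases j with i | i | i | i | i | i
  · filter_upwards [self_mem_nhdsWithin, hle1] with ε hε hε1
    have := haff hε hε1 ha hdj
    change s.interference (z + ε • d).p i - (z.η i + ε * d.η i) < 0
    change s.interference z.p i - z.η i + ε * (s.interferenceLin i d - d.η i) < 0 at this
    rw [interference_eq, map_add, map_smul, smul_eq_mul]
    rw [interference_eq] at this
    linarith
  · have hquad : ∀ᶠ ε : ℝ in 𝓝[>] 0,
        4 * (s.liftedProblem.scalar (.inr (.inl i)) z + s.liftedDeriv z (.inr (.inl i)) d) +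
          ε * (s.θ i * (4 * (d.η i * d.γ i) + (d.η i - d.γ i) ^ 2)) < 0 := by
      have hcont : Continuous fun ε : ℝ =>
          4 * (s.liftedProblem.scalar (.inr (.inl i)) z + s.liftedDeriv z (.inr (.inl i)) d) +
          ε * (s.θ i * (4 * (d.η i * d.γ i) + (d.η i - d.γ i) ^ 2)) := by fun_prop
      exact ((hcont.tendsto 0).mono_left nhdsWithin_le_nhds).eventually_lt_const
        (by linarith)
    filter_upwards [self_mem_nhdsWithin, hle1, hquad] with ε hε hε1 hq
    have hε0 : (0 : ℝ) < ε := hε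
    change z.η i * z.γ i * s.θ i - s.h i * z.p i ≤ 0 at ha
    change 4 * (z.η i * z.γ i * s.θ i - s.h i * z.p i + (s.θ i * (z.η i * d.γ i + z.γ i * d.η i) -
      s.h i * d.p i)) + ε * (s.θ i * (4 * (d.η i * d.γ i) + (d.η i - d.γ i) ^ 2)) < 0 at hq
    change (z.η i + ε * d.η i + (z.γ i + ε * d.γ i)) ^ 2 - 2 * (z.η i - z.γ i) *
      (z.η i + ε * d.η i - (z.γ i + ε * d.γ i)) + (z.η i - z.γ i) ^ 2 -
      4 / s.θ i * (s.h i * (z.p i + ε * d.p i)) < 0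
    rw [sub_neg, div_mul_eq_mul_div, lt_div_iff₀ (hθ i)]
    nlinarith [mul_pos hε0 (neg_pos.2 hq), mul_nonneg (sub_pos.2 hε1).le (neg_nonneg.2 ha)]
  · filter_upwards [self_mem_nhdsWithin, hle1] with ε hε hε1
    have : -z.p i + ε * -d.p i < 0 := haff hε hε1 ha hdj
    change -(z.p i + ε * d.p i) < 0
    linarith
  · filter_upwards [self_mem_nhdsWithin, hle1] with ε hε hε1
    have : z.p i - s.pmax i + ε * d.p i < 0 := haff hε hε1 ha hdj
    change z.p i + ε * d.p i - s.pmax i < 0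
    linarith
  · filter_upwards [self_mem_nhdsWithin, hle1] with ε hε hε1
    have : -z.γ i + ε * -d.γ i < 0 := haff hε hε1 ha hdj
    change -(z.γ i + ε * d.γ i) < 0
    linarith
  · filter_upwards [self_mem_nhdsWithin, hle1] with ε hε hε1
    have : z.γ i - 1 + ε * d.γ i < 0 := haff hε hε1 ha hdj
    change z.γ i + ε * d.γ i - 1 < 0
    linarith

/-- The Mangasarian-Fromovitz condition holds at every feasible point of the lifted problem:
move the powers towards `pmax / 2`, let `η` follow the interference with some extra room, and lower
`γ_i` steeply, or raise it a little if it vanishes. -/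
theorem exists_mangasarianFromovitz_direction (hh : ∀ i, 0 < s.h i) (hpmax : ∀ i, 0 < s.pmax i)
    (hθ : ∀ i, 0 < s.θ i) (hσ : 0 < s.σsq) {z : Point ι n}
    (hz : s.liftedProblem.Feasible z) :
    ∃ d : Point ι n, ∀ j, s.liftedProblem.scalar j z = 0 → s.liftedDeriv z j d < 0 := by
  rw [liftedProblem_feasible_iff] at hz
  obtain ⟨⟨h1, h2, h3, h4, h5, h6⟩, h7⟩ := hz
  have hη : ∀ i, 0 < z.η i := fun i => (interference_pos hh hσ h3 i).trans_le (h1 i)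
  let dp : ι → ℝ := fun i => s.pmax i / 2 - z.p i
  let dη : ι → ℝ := fun i => ∑ j ∈ Finset.univ.erase i, s.h j * dp j + 1
  let dγ : ι → ℝ := fun i =>
    if z.γ i = 0 then s.h i * s.pmax i / (4 * (s.θ i * z.η i))
    else -(s.θ i * (z.γ i * |dη i|) + s.h i * |dp i| + 1) / (s.θ i * z.η i)
  have hθη : ∀ i, 0 < s.θ i * z.η i := fun i => mul_pos (hθ i) (hη i)
  have hγ0 : ∀ i, z.γ i = 0 → s.θ i * z.η i * dγ i = s.h i * s.pmax i / 4 ∧ 0 < dγ i := by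
    intro i hi
    have := hη i
    have := hθ i
    have := hh i
    have := hpmax i
    simp only [dγ, hi, if_true]
    exact ⟨by field_simp, by positivity⟩
  have hγ1 : ∀ i, z.γ i ≠ 0 → s.θ i * z.η i * dγ i =
      -(s.θ i * (z.γ i * |dη i|) + s.h i * |dp i| + 1) ∧ dγ i < 0 := by
    intro i hi
    have h0 := hθη i
    have := hθ i
    have := hh i
    have := h5 i
    simp only [dγ, hi, if_false]
    refine ⟨mul_div_cancel₀ _ h0.ne', div_neg_of_neg_of_pos (neg_neg_of_pos ?_) h0⟩
    positivity
  refine ⟨(dγ, dη, dp, 0), ?_⟩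
  rintro (i | i | i | i | i | i) hi
  · change s.interferenceLin i _ - dη i < 0
    rw [interferenceLin_apply]
    change ∑ j ∈ Finset.univ.erase i, s.h j * dp j - dη i < 0
    simp only [dη]
    linarith
  · simp only [liftedProblem, Sum.elim_inl, Sum.elim_inr] at hi
    change s.θ i * (z.η i * dγ i + z.γ i * dη i) - s.h i * dp i < 0
    by_cases hγ : z.γ i = 0
    · have hp : z.p i = 0 := by
        simpa [hγ, (hh i).ne'] using hi
      have h0 := (hγ0 i hγ).1
      simp only [hγ, dp, hp]
      have := mul_pos (hh i) (hpmax i)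
      linarith
    · have h0 := (hγ1 i hγ).1
      have e1 := mul_le_mul_of_nonneg_left (le_abs_self (dη i)) (mul_nonneg (hθ i).le (h5 i))
      have e2 := mul_le_mul_of_nonneg_left (neg_abs_le (dp i)) (hh i).le
      linarith
  · have hp : z.p i = 0 := by simpa [liftedProblem] using hi
    change -(s.pmax i / 2 - z.p i) < 0
    linarith [hpmax i]
  · have hp : z.p i - s.pmax i = 0 := hi
    change s.pmax i / 2 - z.p i < 0
    linarith [hpmax i]
  · have hγ : z.γ i = 0 := by simpa [liftedProblem] using hi
    change -dγ i < 0
    linarith [(hγ0 i hγ).2]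
  · have hγ : z.γ i - 1 = 0 := hi
    exact (hγ1 i (by linarith)).2

section KKT

variable (hQ : s.Q.PosSemidef) (hPprev : s.Pprev.PosSemidef) (hprior : IsUnit s.priorCov.det)
  (hR : ∀ i, (s.R i).PosDef) (hh : ∀ i, 0 < s.h i) (hpmax : ∀ i, 0 < s.pmax i)
  (hθ : ∀ i, 0 < s.θ i) (hσ : 0 < s.σsq) {z : Point ι n} (hz : s.liftedProblem.Feasible z)
  (hopt : ∀ y : Point ι n, (∀ j, (s.surrogateProblem fun i => z.η i - z.γ i).scalar j y < 0) →
    (s.block y.γ y.P).PosSemidef → z.P.trace ≤ y.P.trace)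
include hQ hPprev hprior hR hθ hz hopt

theorem eventually_trace_le_of_direction {d : Point ι n}
    (hd : ∀ j, s.liftedProblem.scalar j z + s.liftedDeriv z j d < 0) :
    ∀ᶠ ε : ℝ in 𝓝[>] 0, (∀ i, 0 ≤ z.γ i + ε * d.γ i) ∧
      z.P.trace ≤ ((s.information fun i => z.γ i + ε * d.γ i)⁻¹).trace := by
  filter_upwards [eventually_surrogate_scalar_neg hθ hz hd] with ε hε
  have hγ : ∀ i, 0 ≤ z.γ i + ε * d.γ i := fun i => by
    have : -(z.γ i + ε * d.γ i) < 0 := hε (.inr (.inr (.inr (.inr (.inl i)))))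
    linarith
  refine ⟨hγ, hopt (fun i => z.γ i + ε * d.γ i, (z + ε • d).η, (z + ε • d).p,
    (s.information fun i => z.γ i + ε * d.γ i)⁻¹) (fun j => ?_)
    (block_inv_posSemidef hQ hPprev hprior hR hγ)⟩
  have := hε j
  rcases j with i | i | i | i | i | i <;> exact this

include hh hpmax hσ

/-- A feasible point of the lifted problem that no strictly feasible point of its own surrogate
problem improves upon satisfies `Tr P = Tr M(γ)⁻¹`, and the problem with `P` eliminated has
multipliers there. -/
theorem exists_reduced_multipliers :
    z.P.trace = ((s.information z.γ)⁻¹).trace ∧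
    ∃ u : ι ⊕ ι ⊕ ι ⊕ ι ⊕ ι ⊕ ι → ℝ, (∀ j, 0 ≤ u j) ∧
      (∀ j, u j * s.liftedProblem.scalar j z = 0) ∧
      ∀ d, s.reducedDeriv z.γ d + ∑ j, u j * s.liftedDeriv z j d = 0 := by
  have hγ : ∀ i, 0 ≤ z.γ i := ((liftedProblem_feasible_iff.1 hz).1).2.2.2.2.1
  have hle : ((s.information z.γ)⁻¹).trace ≤ z.P.trace :=
    trace_inv_information_le hQ hPprev hprior hR hγ hz.2
  obtain ⟨d₀, hd₀⟩ := exists_mangasarianFromovitz_direction hh hpmax hθ hσ hz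
  have hP : z.P.trace = ((s.information z.γ)⁻¹).trace := by
    refine le_antisymm ?_ hle
    -- A short step along `d₀` makes all linearized constraints negative, active or not.
    obtain ⟨δ, hδ, hδ0⟩ : ∃ δ : ℝ, (∀ j, s.liftedProblem.scalar j z +
        s.liftedDeriv z j (δ • d₀) < 0) ∧ 0 < δ := by
      have hev : ∀ᶠ δ : ℝ in 𝓝[>] 0, ∀ j, s.liftedProblem.scalar j z +
          s.liftedDeriv z j (δ • d₀) < 0 := by
        rw [eventually_all]
        intro j
        simp only [map_smul, smul_eq_mul]
        rcases (hz.1 j).eq_or_lt with h0 | hneg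
        · filter_upwards [self_mem_nhdsWithin] with δ hδ
          rw [h0, zero_add]
          exact mul_neg_of_pos_of_neg hδ (hd₀ j h0)
        · have hcont : Continuous fun δ : ℝ => s.liftedProblem.scalar j z +
              δ * s.liftedDeriv z j d₀ := by fun_prop
          exact ((hcont.tendsto 0).mono_left nhdsWithin_le_nhds).eventually_lt_const
            (by simpa using hneg)
      obtain ⟨δ, h1, h2⟩ := (hev.and self_mem_nhdsWithin).exists
      exact ⟨δ, h1, h2⟩
    have hc : Tendsto (fun ε : ℝ => fun i => z.γ i + ε * (δ • d₀).γ i) (𝓝[>] 0) (𝓝 z.γ) := by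
      have : Continuous fun ε : ℝ => fun i => z.γ i + ε * (δ • d₀).γ i := by fun_prop
      simpa using (this.tendsto 0).mono_left nhdsWithin_le_nhds
    have htr : Continuous fun X : Matrix (Fin n) (Fin n) ℝ => X.trace := by fun_prop
    refine ge_of_tendsto
      ((htr.tendsto _).comp (tendsto_inv_information hQ hPprev hprior hR hγ hc)) ?_
    filter_upwards [eventually_trace_le_of_direction hQ hPprev hprior hR hθ hz hopt hδ] with ε hε
    exact hε.2
  refine ⟨hP, exists_kkt_multipliers (s.reducedDeriv z.γ : Point ι n →ₗ[ℝ] ℝ) _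
    (fun j => (s.liftedDeriv z j : Point ι n →ₗ[ℝ] ℝ)) hz.1 (fun d hd => ?_) ⟨d₀, hd₀⟩⟩
  by_contra! hneg
  have hgain : 0 < ∑ i, d.γ i * s.marginalGain z.γ i := by
    have : s.reducedDeriv z.γ d < 0 := hneg
    simpa [reducedDeriv, mul_comm] using this
  obtain ⟨ε, hlt, hnonneg, hle'⟩ :=
    ((eventually_trace_inv_information_lt hQ hPprev hprior hR hγ hgain).and
      (eventually_trace_le_of_direction hQ hPprev hprior hR hθ hz hopt hd)).exists
  linarith [hlt hnonneg]

theorem lifted_isKKTPoint : s.liftedProblem.IsKKTPoint z := by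
  obtain ⟨hP, u, hu, hcompl, hstat⟩ :=
    exists_reduced_multipliers hQ hPprev hprior hR hh hpmax hθ hσ hz hopt
  have hM : (s.information z.γ).PosDef :=
    information_posDef hQ hPprev hprior hR ((liftedProblem_feasible_iff.1 hz).1).2.2.2.2.1
  refine ⟨hz, u, s.lmiMultiplier z.γ, hu, lmiMultiplier_posSemidef hM, hcompl, ?_, ?_⟩
  · change (s.lmiMultiplier z.γ * s.block z.γ z.P).trace = 0
    simp [trace_lmiMultiplier_mul_block hM, hP]
  · have hlag : s.liftedProblem.lagrangian u (s.lmiMultiplier z.γ) = fun x : Point ι n =>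
        ((s.information z.γ)⁻¹).trace + ∑ j, u j * s.liftedProblem.scalar j x -
          ∑ i, (x.γ i - z.γ i) * s.marginalGain z.γ i := by
      ext x
      change x.P.trace + ∑ j, u j * s.liftedProblem.scalar j x -
        (s.lmiMultiplier z.γ * s.block x.γ x.P).trace = _
      rw [trace_lmiMultiplier_mul_block hM]
      ring
    rw [hlag]
    refine (((HasFDerivAt.fun_sum fun j _ =>
      (hasFDerivAt_lifted_scalar z j).const_mul (u j)).const_add _).sub
      (HasFDerivAt.fun_sum fun i _ =>
        ((hasFDerivAt_γ i z).sub_const (z.γ i)).mul_const (s.marginalGain z.γ i))).congr_fderiv ?_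
    refine ContinuousLinearMap.ext fun d => ?_
    have := hstat d
    rw [reducedDeriv_apply] at this
    rw [_root_.sub_apply, _root_.sum_apply, _root_.sum_apply]
    change ∑ j, u j * s.liftedDeriv z j d - ∑ i, s.marginalGain z.γ i * d.γ i = 0
    linarith

/-- Passing from the lifted to the relaxed problem: a multiplier `μ_i` of
`η_i γ_i θ_i ≤ h_i p_i` becomes the multiplier `μ_i D_i(p)` of the SINR constraint.  If
`D_i(p) < η_i`, then stationarity in `η_i` and complementarity force `μ_i = 0` or `p_i = 0`. -/
theorem relaxed_isKKTPoint (hη : ∀ i, z.p i = 0 → z.η i = s.interference z.p i) :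
    s.relaxedProblem.IsKKTPoint z.toRelaxed := by
  obtain ⟨hP, u, hu, hcompl, hstat⟩ :=
    exists_reduced_multipliers hQ hPprev hprior hR hh hpmax hθ hσ hz hopt
  have hfeas := (liftedProblem_feasible_iff.1 hz).1
  have hM : (s.information z.γ).PosDef :=
    information_posDef hQ hPprev hprior hR hfeas.2.2.2.2.1
  have hD : ∀ i, 0 < s.interference z.p i := interference_pos hh hσ hfeas.2.2.1
  have hcomplη : ∀ i, u (.inl i) * (s.interference z.p i - z.η i) = 0 := fun i => hcompl (.inl i)
  have hcomplμ : ∀ i, u (.inr (.inl i)) * (z.η i * z.γ i * s.θ i - s.h i * z.p i) = 0 :=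
    fun i => hcompl (.inr (.inl i))
  have hstatη : ∀ i, u (.inl i) = u (.inr (.inl i)) * (s.θ i * z.γ i) := fun i => by
    have := hstat ((0, Pi.single i 1, 0, 0) : Point ι n)
    simp [Fintype.sum_sum_type, liftedDeriv, reducedDeriv, interferenceLin_apply, Pi.single_apply,
      Point.γ, Point.η, Point.p] at this ⊢
    linarith
  -- Either `μ_i = 0`, or `η_i = D_i(p)` and the SINR constraint is active.
  have hcase : ∀ i, u (.inr (.inl i)) = 0 ∨ z.η i = s.interference z.p i ∧
      s.h i * z.p i = s.interference z.p i * z.γ i * s.θ i := fun i => by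
    rw [or_iff_not_imp_left]
    intro hμ
    have hactive : z.η i * z.γ i * s.θ i - s.h i * z.p i = 0 :=
      (mul_eq_zero.1 (hcomplμ i)).resolve_left hμ
    have htight : z.η i = s.interference z.p i := by
      by_contra hne
      have hl := (mul_eq_zero.1 (hcomplη i)).resolve_right fun h => hne (by linarith)
      rw [hstatη] at hl
      have hγ : z.γ i = 0 := by simpa [hμ, (hθ i).ne'] using hl
      rw [hγ] at hactive
      exact hne (hη i (by simpa [(hh i).ne'] using hactive))
    exact ⟨htight, by rw [← htight]; linarith⟩
  set v : ι ⊕ ι ⊕ ι ⊕ ι ⊕ ι → ℝ :=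
    Sum.elim (fun i => u (.inr (.inl i)) * s.interference z.p i) (fun j => u (.inr (.inr j)))
    with hv
  have hstat' : ∀ d, s.reducedDeriv z.γ d + ∑ j, v j * s.relaxedDeriv z j d = 0 := fun d => by
    -- Let `η` follow the interference, so that the constraints `D_i(p) ≤ η_i` do not change.
    let e : Point ι n := (d.γ, fun i => s.interferenceLin i d, d.p, 0)
    have hlin : ∀ i, s.interferenceLin i e = s.interferenceLin i d := fun i => by
      rw [interferenceLin_apply, interferenceLin_apply]
    have h0 : ∀ i, s.liftedDeriv z (.inl i) e = 0 := fun i => by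
      change s.interferenceLin i e - s.interferenceLin i d = 0
      rw [hlin, sub_self]
    have h1 : ∀ i, u (.inr (.inl i)) * s.liftedDeriv z (.inr (.inl i)) e =
        v (.inl i) * s.relaxedDeriv z (.inl i) d := fun i => by
      change u (.inr (.inl i)) * (s.θ i * (z.η i * d.γ i + z.γ i * s.interferenceLin i d) -
        s.h i * d.p i) = u (.inr (.inl i)) * s.interference z.p i * (s.θ i * d.γ i -
          (s.h i / s.interference z.p i * d.p i -
            s.h i * z.p i / s.interference z.p i ^ 2 * s.interferenceLin i d))
      have hDi := (hD i).ne'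
      rcases hcase i with h | ⟨h, h'⟩
      · rw [h]; ring
      · rw [h, h']; field_simp; ring
    have h2 : ∀ j, u (.inr (.inr j)) * s.liftedDeriv z (.inr (.inr j)) e =
        v (.inr j) * s.relaxedDeriv z (.inr j) d := fun j => by
      rcases j with i | i | i | i <;> rfl
    have := hstat e
    rw [Fintype.sum_sum_type, Fintype.sum_sum_type] at this
    simp only [h0, h1, h2, mul_zero, Finset.sum_const_zero, zero_add] at this
    rw [reducedDeriv_apply] at this ⊢
    rw [Fintype.sum_sum_type]
    exact this
  refine ⟨relaxed_feasible_of_lifted hh hθ hσ hz, v, s.lmiMultiplier z.γ, ?_,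
    lmiMultiplier_posSemidef hM, ?_, ?_, ?_⟩
  · rintro (i | j)
    · exact mul_nonneg (hu _) (hD i).le
    · exact hu _
  · rintro (i | j)
    · change u (.inr (.inl i)) * s.interference z.p i *
        (z.γ i * s.θ i - s.h i * z.p i / s.interference z.p i) = 0
      have hDi := (hD i).ne'
      rcases hcase i with h | ⟨-, h⟩
      · rw [h]; ring
      · rw [h]; field_simp; ring
    · have := hcompl (.inr (.inr j))
      rcases j with i | i | i | i <;> exact this
  · change (s.lmiMultiplier z.γ * s.block z.γ z.P).trace = 0
    simp [trace_lmiMultiplier_mul_block hM, hP]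
  · have hlag : s.relaxedProblem.lagrangian v (s.lmiMultiplier z.γ) =
        (fun x : Point ι n => ((s.information z.γ)⁻¹).trace +
          ∑ j, v j * s.relaxedProblem.scalar j x.toRelaxed -
            ∑ i, (x.γ i - z.γ i) * s.marginalGain z.γ i) ∘ embedRelaxed ι n := by
      ext x
      change x.P.trace + ∑ j, v j * s.relaxedProblem.scalar j x -
        (s.lmiMultiplier z.γ * s.block x.γ x.P).trace = ((s.information z.γ)⁻¹).trace +
          ∑ j, v j * s.relaxedProblem.scalar j x -
            ∑ i, (x.γ i - z.γ i) * s.marginalGain z.γ i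
      rw [trace_lmiMultiplier_mul_block hM]
      ring
    rw [hlag]
    set z₀ : Point ι n := embedRelaxed ι n z.toRelaxed with hz₀
    have hderiv := ((HasFDerivAt.fun_sum (u := Finset.univ) fun j _ =>
      (hasFDerivAt_relaxed_scalar (z := z₀) (fun i => (hD i).ne') j).const_mul (v j)).const_add
        ((s.information z.γ)⁻¹).trace).sub
      (HasFDerivAt.fun_sum (u := Finset.univ) fun i _ =>
        ((hasFDerivAt_γ i z₀).sub_const (z.γ i)).mul_const (s.marginalGain z.γ i))
    refine (hderiv.comp z.toRelaxed (embedRelaxed ι n).hasFDerivAt).congr_fderiv ?_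
    refine ContinuousLinearMap.ext fun d => ?_
    have := hstat' (embedRelaxed ι n d)
    rw [reducedDeriv_apply] at this
    change (∑ j, v j • s.relaxedDeriv z j - ∑ i, s.marginalGain z.γ i • coordγ n i :
      Point ι n →L[ℝ] ℝ) (embedRelaxed ι n d) = 0
    rw [_root_.sub_apply, _root_.sum_apply, _root_.sum_apply]
    change ∑ j, v j * s.relaxedDeriv z j (embedRelaxed ι n d) -
      ∑ i, s.marginalGain z.γ i * (embedRelaxed ι n d).γ i = 0
    linarith

end KKT

end SensorSystem

/-! ### Runs of the algorithm -/

namespace SensorSystem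

variable {ι : Type*} [Fintype ι] [DecidableEq ι] {n : ℕ} {m : ι → ℕ} {s : SensorSystem ι n m}

theorem IsSCARun.feasible (hθ : ∀ i, 0 < s.θ i) {x : ℕ → Point ι n} (hx : s.IsSCARun x) (t : ℕ) :
    s.liftedProblem.Feasible (x t) := by
  cases t with
  | zero => exact hx.1
  | succ t => exact lifted_feasible_of_surrogate hθ (hx.2 t).1

theorem IsSCARun.antitone_trace (hθ : ∀ i, 0 < s.θ i) {x : ℕ → Point ι n} (hx : s.IsSCARun x) :
    Antitone fun t => (x t).P.trace :=
  antitone_nat_of_succ_le fun t => (hx.2 t).2 _ (surrogate_feasible_self hθ (hx.feasible hθ t))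

theorem IsSCARun.trace_nonneg (hθ : ∀ i, 0 < s.θ i) {x : ℕ → Point ι n} (hx : s.IsSCARun x)
    (t : ℕ) : 0 ≤ (x t).P.trace :=
  (posSemidef_of_block (hx.feasible hθ t).2).trace_nonneg

theorem IsSCARun.isBounded (hQ : s.Q.PosSemidef) (hPprev : s.Pprev.PosSemidef)
    (hprior : IsUnit s.priorCov.det) (hR : ∀ i, (s.R i).PosDef) (hC : ∀ i, s.C i ≠ 0)
    (hh : ∀ i, 0 < s.h i) (hθ : ∀ i, 0 < s.θ i) (hσ : 0 < s.σsq)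
    {x : ℕ → Point ι n} (hx : s.IsSCARun x) : Bornology.IsBounded (Set.range x) := by
  let c : ι → ℝ := fun i =>
    max ((x 0).η i) (max (s.interference s.pmax i) (s.h i * s.pmax i / s.θ i))
  have hηc : ∀ t i, (x t).η i ≤ c i := by
    intro t
    induction t with
    | zero => exact fun i => le_max_left _ _
    | succ t ih =>
      exact fun i => (eta_le_of_isSCAStep hQ hPprev hprior hR hC hh hθ (hx.feasible hθ t)
        (hx.2 t) i).trans (max_le (ih i) (le_max_right _ _))
  have hη0 : ∀ t i, 0 < (x t).η i := fun t i => by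
    have := (liftedProblem_feasible_iff.1 (hx.feasible hθ t)).1
    exact (interference_pos hh hσ this.2.2.1 i).trans_le (this.1 i)
  refine (isBounded_of_bounds (s := s) (∑ i, c i) (x 0).P.trace).subset ?_
  rintro _ ⟨t, rfl⟩
  obtain ⟨⟨h1, h2, h3, h4, h5, h6⟩, h7⟩ := liftedProblem_feasible_iff.1 (hx.feasible hθ t)
  refine ⟨fun i => ⟨h5 i, h6 i⟩, fun i => ⟨h3 i, h4 i⟩, fun i => ?_, posSemidef_of_block h7,
    hx.antitone_trace hθ (Nat.zero_le t)⟩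
  rw [abs_of_pos (hη0 t i)]
  exact (hηc t i).trans (Finset.single_le_sum (f := c)
    (fun j _ => (hη0 t j).le.trans (hηc t j)) (Finset.mem_univ i))

theorem IsSCARun.feasible_of_isConvergedSolution (hθ : ∀ i, 0 < s.θ i) {x : ℕ → Point ι n}
    (hx : s.IsSCARun x) {z : Point ι n} (hz : IsConvergedSolution x z) :
    s.liftedProblem.Feasible z := by
  rcases hz with hz | ⟨t, rfl, -⟩
  · exact isClosed_lifted_feasible.mem_of_mapClusterPt hz
      (Eventually.of_forall fun t => hx.feasible hθ t)
  · exact hx.feasible hθ t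

/-- A strictly feasible point `y` of the surrogate problem at a cluster point `z` stays feasible
for the surrogate problems at all iterates close to `z`, so the next iterate after one of these is
at least as good as `y`; by monotonicity `z` is too. -/
theorem IsSCARun.trace_le_of_isConvergedSolution (hθ : ∀ i, 0 < s.θ i) {x : ℕ → Point ι n}
    (hx : s.IsSCARun x) {z : Point ι n} (hz : IsConvergedSolution x z) {y : Point ι n}
    (hy : ∀ j, (s.surrogateProblem fun i => z.η i - z.γ i).scalar j y < 0)
    (hyP : (s.block y.γ y.P).PosSemidef) : z.P.trace ≤ y.P.trace := by
  rcases hz with hz | ⟨t, rfl, ht⟩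
  · have hfreq : ∃ᶠ t in atTop, ∀ j,
        (s.surrogateProblem fun i => (x t).η i - (x t).γ i).scalar j y < 0 := by
      refine hz.frequently (p := fun w : Point ι n => ∀ j,
        (s.surrogateProblem fun i => w.η i - w.γ i).scalar j y < 0) (eventually_all.2 fun j => ?_)
      have hcont : Continuous fun w : Point ι n =>
          (s.surrogateProblem fun i => w.η i - w.γ i).scalar j y :=
        (continuous_surrogate_scalar j).comp (by fun_prop :
          Continuous fun w : Point ι n => ((fun i => w.η i - w.γ i : ι → ℝ), y))
      exact (hcont.tendsto z).eventually_lt_const (hy j)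
    obtain ⟨t₀, ht₀⟩ := hfreq.exists
    have hstep : (x (t₀ + 1)).P.trace ≤ y.P.trace :=
      (hx.2 t₀).2 y ⟨fun j => (ht₀ j).le, hyP⟩
    have hlim : z ∈ {w : Point ι n | w.P.trace ≤ y.P.trace} :=
      (isClosed_le continuous_trace_P continuous_const).mem_of_mapClusterPt hz
        (eventually_atTop.2 ⟨t₀ + 1, fun t ht => (hx.antitone_trace hθ ht).trans hstep⟩)
    exact hlim
  · have := (hx.2 t).2 y ⟨fun j => (hy j).le, hyP⟩
    rwa [ht] at this

end SensorSystem

theorem proposition2 {ι : Type*} [Fintype ι] [DecidableEq ι] {n : ℕ} {m : ι → ℕ}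
    (s : SensorSystem ι n m)
    (hQ : s.Q.PosSemidef) (hPprev : s.Pprev.PosSemidef) (hprior : IsUnit s.priorCov.det)
    (hR : ∀ i, (s.R i).PosDef) (hC : ∀ i, s.C i ≠ 0)
    (hh : ∀ i, 0 < s.h i) (hpmax : ∀ i, 0 < s.pmax i) (hθ : ∀ i, 0 < s.θ i)
    (hσ : 0 < s.σsq) :
    -- the algorithm is well defined: every surrogate problem that can occur is solvable
    (∀ x, s.liftedProblem.Feasible x → ∃ y, s.IsSCAStep x y) ∧
    ∀ x : ℕ → Point ι n, s.IsSCARun x →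
      -- monotone convergence of the bounded sequence of objective values
      (Antitone fun t => (x t).P.trace) ∧
      (∀ t, 0 ≤ (x t).P.trace) ∧
      (∃ l : ℝ, Tendsto (fun t => (x t).P.trace) atTop (𝓝 l)) ∧
      -- converged solutions exist
      Bornology.IsBounded (Set.range x) ∧
      (∃ z, MapClusterPt z atTop x) ∧
      -- every converged solution is feasible and satisfies the KKT conditions
      ∀ z, IsConvergedSolution x z →
        s.relaxedProblem.Feasible z.toRelaxed ∧
        s.liftedProblem.IsKKTPoint z ∧
        ((∀ i, z.p i = 0 → z.η i = s.interference z.p i) →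
          s.relaxedProblem.IsKKTPoint z.toRelaxed) := by
  refine ⟨fun x hx => SensorSystem.exists_isSCAStep hh hθ hσ hx, fun x hx => ?_⟩
  have hanti := hx.antitone_trace hθ
  have hnonneg := hx.trace_nonneg hθ
  have hbdd := hx.isBounded hQ hPprev hprior hR hC hh hθ hσ
  refine ⟨hanti, hnonneg,
    ⟨_, tendsto_atTop_ciInf hanti ⟨0, Set.forall_mem_range.2 hnonneg⟩⟩, hbdd, ?_, fun z hz => ?_⟩
  · have : ProperSpace (Point ι n) := FiniteDimensional.proper ℝ _
    obtain ⟨z, -, hz⟩ := hbdd.isCompact_closure.exists_mapClusterPt (f := atTop) (u := x)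
      (tendsto_principal.2 (Eventually.of_forall fun t => subset_closure (Set.mem_range_self t)))
    exact ⟨z, hz⟩
  · have hfeas := hx.feasible_of_isConvergedSolution hθ hz
    have hopt := fun y => hx.trace_le_of_isConvergedSolution hθ hz (y := y)
    exact ⟨SensorSystem.relaxed_feasible_of_lifted hh hθ hσ hfeas,
      SensorSystem.lifted_isKKTPoint hQ hPprev hprior hR hh hpmax hθ hσ hfeas hopt,
      SensorSystem.relaxed_isKKTPoint hQ hPprev hprior hR hh hpmax hθ hσ hfeas hopt⟩
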